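/- Notation. Let $n,m\ge 0$ be integers, $\mathbb T^n=\mathbb R^n/\mathbb Z^n$, identified with $Q_n=[-\tfrac12,\tfrac12)^n$, and let $X$ be $\mathbb T^n$ or $\mathbb T^n\times\mathbb R^m$ with Lebesgue measure. A weight on $X$ is a measurable function with values in $(0,\infty)$ almost everywhere. For $1\le p<\infty$ and a weight $w$, $L^p_w(X)$ is the space of measurable $f$ with $\|f\|_{L^p_w}=\|f w^{1/p}\|_{L^p(X)}<\infty$, and $g$ is in weak $L^1_w(X)$ if $g$ is measurable and there is $C<\infty$ with $\int_{\{|g|>\lambda\}}w\le C/\lambda$ for all $\lambda>0$. For measurable $g$ on $\mathbb R^d$ put $$\mathcal M_{1/2}g(x)=\sup_{0<r\le 1/2}\frac1{|B(x,r)|}\int_{B(x,r)}|g(y)|\,dy\in[0,\infty],$$ with Euclidean balls $B(x,r)$. For measurable $f:\mathbb T^n\to\mathbb C$ let $f^*$ be the corresponding $1$-periodic function on $\mathbb R^n$ and $\mathcal M^Tf(x)=\mathcal M_{1/2}f^*(x)$ for $x\in Q_n$; for measurable $f:\mathbb T^n\times\mathbb R^m\to\mathbb C$ let $f^*$ be the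 corresponding function on $\mathbb R^{n+m}$, $1$-periodic in each of the first $n$ variables, and $\mathcal M^{WG}f(x,y)=\mathcal M_{1/2}f^*(x,y)$ for $(x,y)\in Q_n\times\mathbb R^m$. A function is in $L^q_{loc}(X)$ if it is in $L^q(K)$ for every compact $K\subset X$. Proposition 3.3. Let $1<p<\infty$ and $\frac1p+\frac1{p'}=1$. (i) Let $v$ be a weight on $\mathbb T^n$. Then $v^{-1/p}\in L^{p'}(\mathbb T^n)$ if and only if there is a weight $u$ on $\mathbb T^n$ such that $\mathcal M^T$ maps $L^p_v(\mathbb T^n)$ into $L^p_u(\mathbb T^n)$ with $\|\mathcal M^Tf\|_{L^p_u}\le C\|f\|_{L^p_v}$ for all $f\in L^p_v(\mathbb T^n)$, where $C<\infty$ does not depend on $f$. Moreover $v^{-1}\in L^\infty(\mathbb T^n)$ if and only if there is a weight $u$ on $\mathbb T^n$ such that $\mathcal M^T$ maps $L^1_v(\mathbb T^n)$ into weak $L^1_u(\mathbb T^n)$. The last equivalence holds both when "maps into" means only that $\mathcal M^Tf$ is in weak $L^1_u$ for every $f\in L^1_v$, and when it means the weak type bound: $\mathcal M^Tf$ is measurable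 and $\int_{\{\mathcal M^Tf>\lambda\}}u\le\frac C\lambda\|f\|_{L^1_v}$ for all $f\in L^1_v$ and $\lambda>0$, with $C<\infty$ independent of $f$ and $\lambda$. (ii) Let $v$ be a weight on $\mathbb T^n\times\mathbb R^m$. Then $v^{-1/p}\in L^{p'}_{loc}(\mathbb T^n\times\mathbb R^m)$ if and only if there is a weight $u$ on $\mathbb T^n\times\mathbb R^m$ such that $\mathcal M^{WG}$ maps $L^p_v(\mathbb T^n\times\mathbb R^m)$ into $L^p_u(\mathbb T^n\times\mathbb R^m)$ with $\|\mathcal M^{WG}f\|_{L^p_u}\le C\|f\|_{L^p_v}$ for all $f\in L^p_v(\mathbb T^n\times\mathbb R^m)$, where $C<\infty$ does not depend on $f$. Moreover $v^{-1}\in L^\infty_{loc}(\mathbb T^n\times\mathbb R^m)$ if and only if there is a weight $u$ on $\mathbb T^n\times\mathbb R^m$ such that $\mathcal M^{WG}$ maps $L^1_v(\mathbb T^n\times\mathbb R^m)$ into weak $L^1_u(\mathbb T^n\times\mathbb R^m)$, again in either of the two senses described in (i). -/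

import Mathlib

open MeasureTheory Set
open scoped ENNReal NNReal

/-- A (strictly positive) weight: a measurable function with values in `(0, ∞)`, up to null sets. -/
def IsPosWeight {X : Type*} [MeasureSpace X] (w : X → ℝ) : Prop :=
  AEMeasurable w volume ∧ ∀ᵐ x, 0 < w x

/-- The norm `‖g‖_{L^p_w} = ‖g w^{1/p}‖_{L^p} = (∫ |g|^p w)^{1/p}`, as an extended nonnegative number,
for `g` with values in `ℂ` or in `[0, ∞]`. -/
noncomputable def weightedNorm {X ε : Type*} [MeasureSpace X] [ENorm ε]
    (p : ℝ) (w : X → ℝ) (g : X → ε) : ℝ≥0∞ :=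
  (∫⁻ x, ‖g x‖ₑ ^ p * ENNReal.ofReal (w x)) ^ (1 / p)

/-- Membership in the weighted Lebesgue space `L^p_w`. -/
def MemWeightedLp {X ε : Type*} [MeasureSpace X] [TopologicalSpace ε] [ENorm ε]
    (p : ℝ) (w : X → ℝ) (g : X → ε) : Prop :=
  AEStronglyMeasurable g volume ∧ weightedNorm p w g < ∞

/-- The `w`-measure `∫_{|g| > t} w` of the superlevel set `{|g| > t}`. -/
noncomputable def weightedDistrib {X ε : Type*} [MeasureSpace X] [ENorm ε]
    (w : X → ℝ) (g : X → ε) (t : ℝ≥0) : ℝ≥0∞ :=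
  ∫⁻ x in {x | (t : ℝ≥0∞) < ‖g x‖ₑ}, ENNReal.ofReal (w x)

/-- Membership in the weighted space weak `L^1_w`. -/
def MemWeightedWeakL1 {X ε : Type*} [MeasureSpace X] [TopologicalSpace ε] [ENorm ε]
    (w : X → ℝ) (g : X → ε) : Prop :=
  AEStronglyMeasurable g volume ∧
    ∃ C : ℝ≥0, ∀ t : ℝ≥0, 0 < t → weightedDistrib w g t ≤ C / t

/-- Membership in `L^q_loc`: `f` is in `L^q(K)` for every compact `K`. -/
def MemLocLp {X : Type*} [TopologicalSpace X] [MeasureSpace X] (f : X → ℝ) (q : ℝ≥0∞) : Prop :=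
  ∀ K : Set X, IsCompact K → MemLp f q (volume.restrict K)

/-- `T` maps `L^p_v` into `L^p_u` with the norm inequality `‖T f‖_{L^p_u} ≤ C ‖f‖_{L^p_v}`,
the constant `C` being independent of `f`. -/
def MapsStrong {X : Type*} [MeasureSpace X] (T : (X → ℂ) → X → ℝ≥0∞)
    (p : ℝ) (v u : X → ℝ) : Prop :=
  ∃ C : ℝ≥0, ∀ f : X → ℂ, MemWeightedLp p v f →
    MemWeightedLp p u (T f) ∧ weightedNorm p u (T f) ≤ C * weightedNorm p v f

/-- `T` maps `L^1_v` into weak `L^1_u`, as a statement about the spaces only. -/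
def MapsIntoWeak {X : Type*} [MeasureSpace X] (T : (X → ℂ) → X → ℝ≥0∞) (v u : X → ℝ) : Prop :=
  ∀ f : X → ℂ, MemWeightedLp 1 v f → MemWeightedWeakL1 u (T f)

/-- `T` maps `L^1_v` into weak `L^1_u` boundedly:
`u({|T f| > t}) ≤ C ‖f‖_{L^1_v} / t` with `C` independent of `f` and `t`. -/
def MapsWeakBounded {X : Type*} [MeasureSpace X] (T : (X → ℂ) → X → ℝ≥0∞) (v u : X → ℝ) : Prop :=
  ∃ C : ℝ≥0, ∀ f : X → ℂ, MemWeightedLp 1 v f →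
    AEStronglyMeasurable (T f) volume ∧
      ∀ t : ℝ≥0, 0 < t → weightedDistrib u (T f) t ≤ C * weightedNorm 1 v f / t

/-- The local Hardy-Littlewood maximal operator on Euclidean space:
the supremum over `0 < r ≤ R` of the averages of `|g|` over the Euclidean ball `B(x, r)`. -/
noncomputable def localMaximal {ι : Type*} [Fintype ι] (R : ℝ) (g : EuclideanSpace ℝ ι → ℂ)
    (x : EuclideanSpace ℝ ι) : ℝ≥0∞ :=
  ⨆ r ∈ Ioc (0 : ℝ) R,
    (volume (Metric.ball x r))⁻¹ * ∫⁻ y in Metric.ball x r, ‖g y‖ₑ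

/-- The representative in `[-1/2, 1/2)` of a point of the circle `ℝ/ℤ`. -/
noncomputable def circleRep (x : UnitAddCircle) : ℝ :=
  (AddCircle.equivIco (1 : ℝ) (-1 / 2) x : ℝ)

/-- The `1`-periodic function on `ℝⁿ` corresponding to a function on the torus `ℝⁿ/ℤⁿ`. -/
def torusPeriodize {n : ℕ} (f : UnitAddTorus (Fin n) → ℂ) (x : EuclideanSpace ℝ (Fin n)) : ℂ :=
  f (fun i => (x i : UnitAddCircle))

/-- The maximal operator on the torus, `M^T f (x) = M_{1/2} f^* (x)` for `x ∈ [-1/2, 1/2)ⁿ`. -/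
noncomputable def torusMaximal (n : ℕ) (f : UnitAddTorus (Fin n) → ℂ)
    (x : UnitAddTorus (Fin n)) : ℝ≥0∞ :=
  localMaximal (1 / 2) (torusPeriodize f) (WithLp.toLp 2 fun i => circleRep (x i))

/-- The waveguide manifold `𝕋ⁿ × ℝᵐ`, with the product measure. -/
abbrev Waveguide (n m : ℕ) : Type := UnitAddTorus (Fin n) × EuclideanSpace ℝ (Fin m)

/-- The function on `ℝ^{n+m}`, `1`-periodic in the first `n` variables, corresponding to a
function on the waveguide manifold. -/
def waveguidePeriodize {n m : ℕ} (f : Waveguide n m → ℂ)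
    (z : EuclideanSpace ℝ (Fin n ⊕ Fin m)) : ℂ :=
  f (fun i => (z (Sum.inl i) : UnitAddCircle), WithLp.toLp 2 fun j => z (Sum.inr j))

/-- The maximal operator on the waveguide manifold, `M^{WG} f (x, y) = M_{1/2} f^* (x, y)` for
`(x, y) ∈ [-1/2, 1/2)ⁿ × ℝᵐ`, where `M_{1/2}` is taken on `ℝ^{n+m}`. -/
noncomputable def waveguideMaximal (n m : ℕ) (f : Waveguide n m → ℂ) (z : Waveguide n m) : ℝ≥0∞ :=
  localMaximal (1 / 2) (waveguidePeriodize f)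
    (WithLp.toLp 2 (Sum.elim (fun i => circleRep (z.1 i)) fun j => z.2 j))

/-!
Both covering spaces are handled through one local maximal operator `M`, read off at lifted points.

Sufficiency, `p > 1`: with the dual weight `σ = v^{1-p'}` and `dμ = σ dx` pulled back to `ℝᵈ`,
averages factor as `⨍ f = (⨍ f / σ dμ) (⨍ σ)`, so `M f ≤ M_μ(f / σ) · M σ`. The centred maximal
operator `M_μ` of any locally finite measure is bounded on `L^p(μ)` by the Besicovitch covering
theorem, and `∫ (f / σ)^p dμ = ∫ f^p v`. Hence `u = σ / (1 + M σ)^p` works. For `p = 1` the weak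
type inequality holds on each piece of a bounded exhaustion, and `u` is the sum of the indicators of
the pieces with small coefficients.

Necessity: on a small piece `U` one has `M φ ≥ c ∫_U φ`. For `p > 1` test on truncations of `σ`.
For `p = 1` with no uniform constant, finiteness of `∫_U φ` for every `φ ∈ L^1_v` already forces
`dx ≤ B v dx` on `U`, since otherwise a series of bumps would diverge in one norm only.
-/

section Layercake

variable {α : Type*} [MeasurableSpace α] {μ : Measure α}

theorem setLIntegral_Ioi_rpow_eq_top (s : ℝ) :
    ∫⁻ t in Ioi (0 : ℝ), ENNReal.ofReal (t ^ s) = ∞ := by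
  by_contra h
  refine not_integrableOn_Ioi_rpow s ⟨by fun_prop, ?_⟩
  rw [hasFiniteIntegral_iff_ofReal]
  · exact lt_top_iff_ne_top.2 h
  · filter_upwards [ae_restrict_mem measurableSet_Ioi] with t ht
    exact Real.rpow_nonneg (le_of_lt ht) s

theorem lintegral_ennreal_rpow_eq_lintegral_meas_lt_mul {f : α → ℝ≥0∞} (hf : AEMeasurable f μ)
    {p : ℝ} (hp : 0 < p) :
    ∫⁻ x, f x ^ p ∂μ = ENNReal.ofReal p *
      ∫⁻ t in Ioi (0 : ℝ), μ {x | ENNReal.ofReal t < f x} * ENNReal.ofReal (t ^ (p - 1)) := by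
  by_cases hfin : ∀ᵐ x ∂μ, f x ≠ ∞
  · calc ∫⁻ x, f x ^ p ∂μ = ∫⁻ x, ENNReal.ofReal ((f x).toReal ^ p) ∂μ := by
          refine lintegral_congr_ae (hfin.mono fun x hx => ?_)
          dsimp only
          rw [← ENNReal.ofReal_rpow_of_nonneg ENNReal.toReal_nonneg hp.le, ENNReal.ofReal_toReal hx]
      _ = _ := lintegral_rpow_eq_lintegral_meas_lt_mul μ
          (ae_of_all μ fun _ => ENNReal.toReal_nonneg) hf.ennreal_toReal hp
      _ = _ := by
          refine congrArg _ ?_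
          refine setLIntegral_congr_fun measurableSet_Ioi fun t ht => ?_
          refine congrArg (· * _) ?_
          refine measure_congr (Filter.eventuallyEq_set.2 (hfin.mono fun x hx => ?_))
          exact (ENNReal.ofReal_lt_iff_lt_toReal (le_of_lt ht) hx).symm
  · have hpos : μ {x | f x = ∞} ≠ 0 := by simpa [ae_iff] using hfin
    have hleft : ∫⁻ x, f x ^ p ∂μ = ∞ := by
      by_contra h
      refine hfin ((ae_lt_top' (hf.pow_const p) h).mono fun x hx => ?_)
      exact ((ENNReal.rpow_lt_top_iff_of_pos hp).1 hx).ne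
    have hright : ∫⁻ t in Ioi (0 : ℝ),
        μ {x | ENNReal.ofReal t < f x} * ENNReal.ofReal (t ^ (p - 1)) = ∞ := by
      refine top_le_iff.1 ?_
      calc ∞ = μ {x | f x = ∞} * ∫⁻ t in Ioi (0 : ℝ), ENNReal.ofReal (t ^ (p - 1)) := by
            rw [setLIntegral_Ioi_rpow_eq_top, ENNReal.mul_top hpos]
        _ = ∫⁻ t in Ioi (0 : ℝ), μ {x | f x = ∞} * ENNReal.ofReal (t ^ (p - 1)) :=
            (lintegral_const_mul _ (by fun_prop)).symm
        _ ≤ _ := by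
            gcongr with t
            exact fun hx => hx ▸ ENNReal.ofReal_lt_top
    rw [hleft, hright, ENNReal.mul_top (by simpa using hp)]

theorem lintegral_const_mul_rpow_withDensity {h : α → ℝ≥0∞} (hh : Measurable h) {p : ℝ}
    (hp : 1 < p) (c : ℝ≥0∞) :
    ∫⁻ x, (c * h x) ^ (p - 1) ∂μ.withDensity h = c ^ (p - 1) * ∫⁻ x, h x ^ p ∂μ := by
  have hp' : 0 ≤ p - 1 := (sub_pos.2 hp).le
  rw [lintegral_withDensity_eq_lintegral_mul _ hh (by fun_prop),
    ← lintegral_const_mul _ (by fun_prop)]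
  refine lintegral_congr fun x => ?_
  have hpow : h x ^ p = h x * h x ^ (p - 1) := by
    conv_rhs => rw [← ENNReal.rpow_one (h x), ← ENNReal.rpow_mul, one_mul,
      ← ENNReal.rpow_add_of_nonneg _ _ zero_le_one hp', add_sub_cancel]
  rw [Pi.mul_apply, ENNReal.mul_rpow_of_nonneg _ _ hp', mul_left_comm, hpow]

theorem lintegral_rpow_le_of_mul_meas_lt_le {F h : α → ℝ≥0∞} (hF : AEMeasurable F μ)
    (hh : Measurable h) {p : ℝ} (hp : 1 < p) {A : ℝ≥0∞} (hA : A ≠ ∞)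
    (hdistrib : ∀ t : ℝ, 0 < t → ENNReal.ofReal t * μ {x | ENNReal.ofReal t < F x} ≤
      A * ∫⁻ x in {x | ENNReal.ofReal t < 2 * h x}, h x ∂μ) :
    ∫⁻ x, F x ^ p ∂μ ≤
      ENNReal.ofReal p * A * (ENNReal.ofReal (p - 1))⁻¹ * 2 ^ (p - 1) * ∫⁻ x, h x ^ p ∂μ := by
  have hp' : 0 < p - 1 := sub_pos.2 hp
  have hsplit : ∀ t ∈ Ioi (0 : ℝ), μ {x | ENNReal.ofReal t < F x} * ENNReal.ofReal (t ^ (p - 1)) ≤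
      A * (μ.withDensity h {x | ENNReal.ofReal t < 2 * h x} *
        ENNReal.ofReal (t ^ (p - 1 - 1))) := by
    intro t ht
    have hpow : t ^ (p - 1) = t * t ^ (p - 1 - 1) := by
      rw [← Real.rpow_one_add' (le_of_lt ht) (by linarith), add_sub_cancel]
    rw [withDensity_apply _ (measurableSet_lt measurable_const (hh.const_mul 2)), ← mul_assoc, hpow,
      ENNReal.ofReal_mul (le_of_lt ht), ← mul_assoc, mul_comm (μ _)]
    exact mul_le_mul_left (hdistrib t ht) _
  have hlayer := lintegral_ennreal_rpow_eq_lintegral_meas_lt_mul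
    (μ := μ.withDensity h) (hh.const_mul 2).aemeasurable hp'
  have hp0 : ENNReal.ofReal (p - 1) ≠ 0 := by simpa using hp
  calc ∫⁻ x, F x ^ p ∂μ
      = ENNReal.ofReal p * ∫⁻ t in Ioi (0 : ℝ),
          μ {x | ENNReal.ofReal t < F x} * ENNReal.ofReal (t ^ (p - 1)) :=
        lintegral_ennreal_rpow_eq_lintegral_meas_lt_mul hF (by linarith)
    _ ≤ ENNReal.ofReal p * (A * ∫⁻ t in Ioi (0 : ℝ),
          μ.withDensity h {x | ENNReal.ofReal t < 2 * h x} *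
            ENNReal.ofReal (t ^ (p - 1 - 1))) := by
        rw [← lintegral_const_mul' _ _ hA]
        exact mul_le_mul_right (setLIntegral_mono' measurableSet_Ioi hsplit) _
    _ = ENNReal.ofReal p * (A * ((ENNReal.ofReal (p - 1))⁻¹ *
          ∫⁻ x, (2 * h x) ^ (p - 1) ∂μ.withDensity h)) := by
        rw [hlayer, ENNReal.inv_mul_cancel_left hp0 ENNReal.ofReal_ne_top]
    _ = _ := by rw [lintegral_const_mul_rpow_withDensity hh hp]; simp only [mul_assoc]

end Layercake

section CenteredMaximal

open Metric

/-- The centred maximal function of `h` at scales up to `R` with respect to the measure `μ`: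
the supremum over `0 < r ≤ R` of the `μ`-averages of `h` over the balls `B(x, r)`. A ball of measure
zero contributes `0`. -/
noncomputable def centeredMaximal {E : Type*} [PseudoMetricSpace E] [MeasurableSpace E]
    (μ : Measure E) (R : ℝ) (h : E → ℝ≥0∞) (x : E) : ℝ≥0∞ :=
  ⨆ r ∈ Ioc (0 : ℝ) R, (μ (ball x r))⁻¹ * ∫⁻ y in ball x r, h y ∂μ

theorem exists_lt_measure_closedBall {E : Type*} [PseudoMetricSpace E] [MeasurableSpace E]
    {ν : Measure E} {x : E} {r : ℝ} (hr : 0 < r) {a : ℝ≥0∞} (ha : a < ν (ball x r)) :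
    ∃ s ∈ Ioo 0 r, a < ν (closedBall x s) := by
  obtain ⟨s, hs_mono, hs_mem, hs_lim⟩ := exists_seq_strictMono_tendsto' hr
  have hunion : ⋃ n, closedBall x (s n) = ball x r := by
    refine Subset.antisymm (iUnion_subset fun n => closedBall_subset_ball (hs_mem n).2) ?_
    intro y hy
    obtain ⟨n, hn⟩ := (hs_lim.eventually (lt_mem_nhds (mem_ball.1 hy))).exists
    exact mem_iUnion.2 ⟨n, mem_closedBall.2 hn.le⟩
  have hmono : Monotone fun n => closedBall x (s n) :=
    fun _ _ hij => closedBall_subset_closedBall (hs_mono.monotone hij)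
  rw [← hunion, hmono.measure_iUnion] at ha
  obtain ⟨n, hn⟩ := lt_iSup_iff.1 ha
  exact ⟨s n, hs_mem n, hn⟩

theorem centeredMaximal_le_indicator_add {E : Type*} [PseudoMetricSpace E]
    [MeasurableSpace E] {μ : Measure E} {R : ℝ} (h : E → ℝ≥0∞) (t : ℝ≥0∞) (x : E) :
    centeredMaximal μ R h x ≤ centeredMaximal μ R ({y | t < 2 * h y}.indicator h) x + t / 2 := by
  refine iSup₂_le fun r hr => ?_
  have hpoint : ∀ y, h y ≤ {y | t < 2 * h y}.indicator h y + t / 2 := by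
    intro y
    by_cases hy : t < 2 * h y
    · simp [indicator_of_mem (show y ∈ {y | t < 2 * h y} from hy)]
    · rw [indicator_of_notMem (show y ∉ {y | t < 2 * h y} from hy), zero_add,
        ENNReal.le_div_iff_mul_le (.inl two_ne_zero) (.inl ENNReal.ofNat_ne_top), mul_comm]
      exact not_lt.1 hy
  calc (μ (ball x r))⁻¹ * ∫⁻ y in ball x r, h y ∂μ
      ≤ (μ (ball x r))⁻¹ * ∫⁻ y in ball x r, ({y | t < 2 * h y}.indicator h y + t / 2) ∂μ := by
        gcongr with y
        exact hpoint y
    _ = (μ (ball x r))⁻¹ * ∫⁻ y in ball x r, {y | t < 2 * h y}.indicator h y ∂μ +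
          (μ (ball x r))⁻¹ * μ (ball x r) * (t / 2) := by
        rw [lintegral_add_right _ measurable_const, setLIntegral_const]
        ring
    _ ≤ _ := by
        gcongr
        · exact le_iSup₂_of_le r hr le_rfl
        · exact mul_le_of_le_one_left' (ENNReal.inv_mul_le_one _)

section ProperSpace

variable {E : Type*} [PseudoMetricSpace E] [ProperSpace E] [MeasurableSpace E]
  {μ : Measure E} [IsFiniteMeasureOnCompacts μ] {R r : ℝ} {h : E → ℝ≥0∞} {x : E} {t : ℝ≥0∞}

theorem lt_centeredMaximal_iff : t < centeredMaximal μ R h x ↔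
    ∃ r ∈ Ioc 0 R, t * μ (ball x r) < ∫⁻ y in ball x r, h y ∂μ := by
  simp only [centeredMaximal, lt_iSup_iff, exists_prop]
  refine exists_congr fun r => and_congr_right fun _ => ?_
  rcases eq_or_ne (μ (ball x r)) 0 with h0 | h0
  · simp [Measure.restrict_eq_zero.2 h0]
  · rw [mul_comm, ← div_eq_mul_inv,
      ENNReal.lt_div_iff_mul_lt (.inl h0) (.inl measure_ball_lt_top.ne)]

theorem setLIntegral_ball_le_mul_centeredMaximal (hr : r ∈ Ioc 0 R) :
    ∫⁻ y in ball x r, h y ∂μ ≤ μ (ball x r) * centeredMaximal μ R h x := by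
  by_contra! hlt
  rw [mul_comm] at hlt
  exact lt_irrefl _ (lt_centeredMaximal_iff.2 ⟨r, hr, hlt⟩)

theorem centeredMaximal_mul_le [OpensMeasurableSpace E] {σ g : E → ℝ≥0∞} (hσ : Measurable σ)
    (hg : Measurable g) [IsFiniteMeasureOnCompacts (μ.withDensity σ)] :
    centeredMaximal μ R (fun y => σ y * g y) x ≤
      centeredMaximal (μ.withDensity σ) R g x * centeredMaximal μ R σ x := by
  refine iSup₂_le fun r hr => ?_
  have hball : μ.withDensity σ (ball x r) ≤ μ (ball x r) * centeredMaximal μ R σ x :=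
    (withDensity_apply _ measurableSet_ball).trans_le (setLIntegral_ball_le_mul_centeredMaximal hr)
  calc (μ (ball x r))⁻¹ * ∫⁻ y in ball x r, σ y * g y ∂μ
      = (μ (ball x r))⁻¹ * ∫⁻ y in ball x r, g y ∂μ.withDensity σ := by
        rw [setLIntegral_withDensity_eq_setLIntegral_mul μ hσ hg measurableSet_ball]; rfl
    _ ≤ (μ (ball x r))⁻¹ * (μ (ball x r) * centeredMaximal μ R σ x *
          centeredMaximal (μ.withDensity σ) R g x) := by
        gcongr
        exact (setLIntegral_ball_le_mul_centeredMaximal hr).trans (by gcongr)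
    _ = (μ (ball x r))⁻¹ * μ (ball x r) *
          (centeredMaximal (μ.withDensity σ) R g x * centeredMaximal μ R σ x) := by ring
    _ ≤ _ := mul_le_of_le_one_left' (ENNReal.inv_mul_le_one _)

theorem measurable_measure_ball [OpensMeasurableSpace E] (ν : Measure E) [SFinite ν] (r : ℝ) :
    Measurable fun x => ν (ball x r) :=
  measurable_measure_prodMk_left (s := {z : E × E | dist z.2 z.1 < r})
    (measurableSet_lt (by fun_prop) measurable_const)

theorem measurable_centeredMaximal [OpensMeasurableSpace E] (μ : Measure E)
    [IsFiniteMeasureOnCompacts μ] (R : ℝ) (h : E → ℝ≥0∞) : Measurable (centeredMaximal μ R h) := by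
  refine measurable_of_Ioi fun t => ?_
  have hrat : centeredMaximal μ R h ⁻¹' Ioi t = ⋃ q : ℚ, ⋃ _ : (q : ℝ) ∈ Ioc 0 R,
      {x | t * μ (ball x q) < μ.withDensity h (ball x q)} := by
    ext x
    simp only [mem_preimage, mem_Ioi, mem_iUnion, mem_ofPred_eq, exists_prop,
      withDensity_apply h measurableSet_ball, lt_centeredMaximal_iff]
    refine ⟨fun ⟨r, hr, hlt⟩ => ?_, fun ⟨q, hq, hlt⟩ => ⟨q, hq, hlt⟩⟩
    simp only [← withDensity_apply h measurableSet_ball] at hlt ⊢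
    obtain ⟨s, hs, hlt⟩ := exists_lt_measure_closedBall hr.1 hlt
    obtain ⟨q, hsq, hqr⟩ := exists_rat_btwn hs.2
    refine ⟨q, ⟨hs.1.trans hsq, hqr.le.trans hr.2⟩, lt_of_le_of_lt ?_ (hlt.trans_le ?_)⟩
    · gcongr
    · exact measure_mono (closedBall_subset_ball hsq)
  rw [hrat]
  exact .iUnion fun q => .iUnion fun _ => measurableSet_lt
    ((measurable_measure_ball μ q).const_mul t) (measurable_measure_ball (μ.withDensity h) q)

end ProperSpace

section Besicovitch

variable {E : Type*} [NormedAddCommGroup E] [NormedSpace ℝ E] [FiniteDimensional ℝ E]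
  [MeasurableSpace E] [BorelSpace E] {μ : Measure E} {R : ℝ}

theorem measure_le_multiplicity_mul_of_ball_lt {ν : Measure E} {A : Set E}
    (hA : ∀ x ∈ A, ∃ r ∈ Ioc 0 R, μ (ball x r) < ν (ball x r)) :
    μ A ≤ Besicovitch.multiplicity E * ν univ := by
  have hclosed : ∀ x : A, ∃ r ∈ Ioc 0 R, μ (closedBall (x : E) r) ≤ ν (closedBall (x : E) r) := by
    rintro ⟨x, hx⟩
    obtain ⟨r, hr, hlt⟩ := hA x hx
    obtain ⟨s, hs, hlt⟩ := exists_lt_measure_closedBall hr.1 hlt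
    exact ⟨s, ⟨hs.1, hs.2.le.trans hr.2⟩,
      (measure_mono (closedBall_subset_ball hs.2)).trans hlt.le⟩
  choose r hr hle using hclosed
  obtain ⟨s, hdisj, hcover⟩ := Besicovitch.exist_disjoint_covering_families
    (Besicovitch.one_lt_goodτ E) (Besicovitch.isEmpty_satelliteConfig_multiplicity E)
    (β := A) ⟨(↑), r, fun x => (hr x).1, R, fun x => (hr x).2⟩
  have hcountable : ∀ i, (s i).Countable := fun i =>
    (hdisj i).countable_of_nonempty_interior fun x _ =>
      ⟨x, ball_subset_interior_closedBall (mem_ball_self (hr x).1)⟩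
  have hfamily : ∀ i, μ (⋃ j ∈ s i, closedBall (j : E) (r j)) ≤ ν univ := fun i =>
    calc μ (⋃ j ∈ s i, closedBall (j : E) (r j))
        ≤ ∑' j : s i, μ (closedBall ((j : A) : E) (r j)) := measure_biUnion_le μ (hcountable i) _
      _ ≤ ∑' j : s i, ν (closedBall ((j : A) : E) (r j)) := ENNReal.tsum_le_tsum fun j => hle j
      _ = ν (⋃ j ∈ s i, closedBall (j : E) (r j)) :=
          (measure_biUnion (hcountable i) (hdisj i)
            fun _ _ => isClosed_closedBall.measurableSet).symm
      _ ≤ ν univ := measure_mono (subset_univ _)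
  calc μ A ≤ μ (⋃ i, ⋃ j ∈ s i, closedBall (j : E) (r j)) := by
        rw [Subtype.range_coe] at hcover
        exact measure_mono (hcover.trans
          (iUnion_mono fun i => iUnion₂_mono fun j _ => ball_subset_closedBall))
    _ ≤ ∑ i, μ (⋃ j ∈ s i, closedBall (j : E) (r j)) := measure_iUnion_fintype_le _ _
    _ ≤ ∑ _i : Fin (Besicovitch.multiplicity E), ν univ := Finset.sum_le_sum fun i _ => hfamily i
    _ = Besicovitch.multiplicity E * ν univ := by simp

variable [IsFiniteMeasureOnCompacts μ]

theorem mul_meas_lt_centeredMaximal_le {h : E → ℝ≥0∞} {S A : Set E}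
    (hS : ∀ x ∈ A, ball x R ⊆ S) (t : ℝ≥0∞) :
    t * μ (A ∩ {x | t < centeredMaximal μ R h x}) ≤
      Besicovitch.multiplicity E * ∫⁻ y in S, h y ∂μ := by
  have hbesicovitch : (t • μ) (A ∩ {x | t < centeredMaximal μ R h x}) ≤
      Besicovitch.multiplicity E * (μ.restrict S).withDensity h univ := by
    refine measure_le_multiplicity_mul_of_ball_lt (R := R) ?_
    rintro x ⟨hxA, hx⟩
    obtain ⟨r, hr, hlt⟩ := lt_centeredMaximal_iff.1 hx
    refine ⟨r, hr, ?_⟩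
    rwa [withDensity_apply _ measurableSet_ball, Measure.restrict_restrict measurableSet_ball,
      inter_eq_left.2 ((ball_subset_ball hr.2).trans (hS x hxA))]
  simpa using hbesicovitch

/-- The constant in the strong type `(p, p)` inequality for the centred maximal function on `E` with
respect to an arbitrary measure; it is finite for `1 < p`. -/
noncomputable def strongTypeConst (E : Type*) [NormedAddCommGroup E] (p : ℝ) : ℝ≥0∞ :=
  ENNReal.ofReal p * (2 * Besicovitch.multiplicity E) * (ENNReal.ofReal (p - 1))⁻¹ * 2 ^ (p - 1)

theorem strongTypeConst_ne_top (E : Type*) [NormedAddCommGroup E] {p : ℝ} (hp : 1 < p) :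
    strongTypeConst E p ≠ ∞ := by
  have hp' : ENNReal.ofReal (p - 1) ≠ 0 := by simpa using hp
  have : (2 : ℝ≥0∞) ^ (p - 1) ≠ ∞ :=
    ENNReal.rpow_ne_top_of_nonneg (sub_pos.2 hp).le ENNReal.ofNat_ne_top
  unfold strongTypeConst
  finiteness

theorem lintegral_centeredMaximal_rpow_le {h : E → ℝ≥0∞} (hh : Measurable h) {p : ℝ}
    (hp : 1 < p) :
    ∫⁻ x, centeredMaximal μ R h x ^ p ∂μ ≤
      strongTypeConst E p * ∫⁻ x, h x ^ p ∂μ := by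
  refine lintegral_rpow_le_of_mul_meas_lt_le (measurable_centeredMaximal μ R h).aemeasurable hh hp
    (by finiteness) fun t _ => ?_
  set s := ENNReal.ofReal t
  have hset : MeasurableSet {y | s < 2 * h y} :=
    measurableSet_lt measurable_const (hh.const_mul 2)
  have hsub : {x | s < centeredMaximal μ R h x} ⊆
      univ ∩ {x | s / 2 < centeredMaximal μ R ({y | s < 2 * h y}.indicator h) x} := by
    refine fun x (hx : s < _) => ⟨mem_univ x, mem_ofPred.2 ?_⟩
    by_contra! hle
    refine hx.not_ge ?_
    calc centeredMaximal μ R h x ≤ _ := centeredMaximal_le_indicator_add h s x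
      _ ≤ s / 2 + s / 2 := by gcongr
      _ = s := ENNReal.add_halves s
  calc s * μ {x | s < centeredMaximal μ R h x}
      ≤ 2 * (s / 2 * μ (univ ∩
          {x | s / 2 < centeredMaximal μ R ({y | s < 2 * h y}.indicator h) x})) := by
        rw [← mul_assoc, ENNReal.mul_div_cancel two_ne_zero ENNReal.ofNat_ne_top]
        gcongr
    _ ≤ 2 * (Besicovitch.multiplicity E * ∫⁻ y in univ, {y | s < 2 * h y}.indicator h y ∂μ) := by
        exact mul_le_mul_right (mul_meas_lt_centeredMaximal_le (fun _ _ => subset_univ _) _) 2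
    _ = 2 * Besicovitch.multiplicity E * ∫⁻ x in {x | s < 2 * h x}, h x ∂μ := by
        rw [setLIntegral_univ, lintegral_indicator hset, mul_assoc]

end Besicovitch

end CenteredMaximal

theorem eq_zero_of_forall_nat_mul_le {a b : ℝ≥0∞} (hb : b ≠ ∞) (h : ∀ n : ℕ, n * a ≤ b) :
    a = 0 := by
  by_contra ha
  obtain ⟨n, hn⟩ := ENNReal.exists_nat_mul_gt ha hb
  exact hn.not_ge (h n)

theorem mul_rpow_mul_div_one_add_rpow_le {p : ℝ} (hp : 0 ≤ p) (a b s : ℝ≥0∞) :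
    (a * b) ^ p * (s / (1 + b) ^ p) ≤ s * a ^ p := by
  calc (a * b) ^ p * (s / (1 + b) ^ p) = s * a ^ p * (b ^ p / (1 + b) ^ p) := by
        rw [ENNReal.mul_rpow_of_nonneg _ _ hp]
        simp only [div_eq_mul_inv]
        ring
    _ ≤ s * a ^ p := mul_le_of_le_one_right' <|
        ENNReal.div_le_of_le_mul (by rw [one_mul]; gcongr; exact le_add_self)

/-- A measure space `X` presented by a continuous map `proj : E → X` together with a section `lift`.
The balls of radius `R` centred at lifted points lie in `region`, on which `proj` covers `X` at most
`multiplicity` times, measured in volume. For `𝕋ⁿ` the map is `ℝⁿ → ℝⁿ/ℤⁿ`. -/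
structure EuclideanCover (X E : Type*) [TopologicalSpace X] [MeasureSpace X] [PseudoMetricSpace E]
    [MeasureSpace E] (R : ℝ) where
  proj : E → X
  lift : X → E
  region : Set E
  multiplicity : ℝ≥0
  radius_pos : 0 < R
  continuous_proj : Continuous proj
  proj_lift : ∀ x, proj (lift x) = x
  measurable_lift : Measurable lift
  map_lift_le : (volume : Measure X).map lift ≤ volume.restrict region
  ball_subset : ∀ x, Metric.ball (lift x) R ⊆ region
  map_proj_le : (volume.restrict region).map proj ≤ multiplicity • volume
  isBounded_lift : ∀ K, IsCompact K → Bornology.IsBounded (lift '' K)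

namespace EuclideanCover

open Metric

section Basic

variable {X E : Type*} [TopologicalSpace X] [MeasureSpace X] [PseudoMetricSpace E]
  [MeasureSpace E] {R : ℝ} (c : EuclideanCover X E R)

/-- The centred maximal function on `E`, up to the scale `R`, of the pullback of `h`, read off at
lifted points. -/
noncomputable def maximal (h : X → ℝ≥0∞) (x : X) : ℝ≥0∞ :=
  centeredMaximal volume R (fun z => h (c.proj z)) (c.lift x)

theorem volume_lift_preimage_le {s : Set E} (hs : MeasurableSet s) :
    volume (c.lift ⁻¹' s) ≤ volume.restrict c.region s := by
  rw [← Measure.map_apply c.measurable_lift hs]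
  exact c.map_lift_le s

theorem lintegral_lift_le {F : E → ℝ≥0∞} (hF : Measurable F) :
    ∫⁻ x, F (c.lift x) ≤ ∫⁻ z in c.region, F z := by
  rw [← lintegral_map hF c.measurable_lift]
  exact lintegral_mono' c.map_lift_le le_rfl

variable [OpensMeasurableSpace E]

theorem maximal_eq_centeredMaximal_restrict (h : X → ℝ≥0∞) (x : X) :
    c.maximal h x =
      centeredMaximal (volume.restrict c.region) R (fun z => h (c.proj z)) (c.lift x) := by
  refine biSup_congr fun r hr => ?_
  have hsub : ball (c.lift x) r ⊆ c.region := (ball_subset_ball hr.2).trans (c.ball_subset x)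
  rw [Measure.restrict_restrict measurableSet_ball, Measure.restrict_apply measurableSet_ball,
    inter_eq_left.2 hsub]

theorem measurable_maximal [ProperSpace E] [IsFiniteMeasureOnCompacts (volume : Measure E)]
    (h : X → ℝ≥0∞) : Measurable (c.maximal h) :=
  (measurable_centeredMaximal _ _ _).comp c.measurable_lift

variable [BorelSpace X]

theorem maximal_congr {g h : X → ℝ≥0∞} (hgh : g =ᵐ[volume] h) : c.maximal g = c.maximal h := by
  have hproj : Measurable c.proj := c.continuous_proj.measurable
  have hae : ∀ᵐ z ∂volume.restrict c.region, g (c.proj z) = h (c.proj z) :=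
    ae_of_ae_map hproj.aemeasurable <|
      ((Measure.absolutelyContinuous_of_le c.map_proj_le).trans
        Measure.smul_absolutelyContinuous) hgh
  funext x
  simp only [maximal_eq_centeredMaximal_restrict]
  refine biSup_congr fun r _ => ?_
  rw [lintegral_congr_ae (ae_restrict_of_ae hae)]

theorem setLIntegral_proj_le {h : X → ℝ≥0∞} (hh : Measurable h) {K : Set X} (hK : MeasurableSet K)
    {s : Set E} (hs : MapsTo c.proj s K) :
    ∫⁻ z in s, h (c.proj z) ∂volume.restrict c.region ≤ c.multiplicity * ∫⁻ x in K, h x := by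
  have hproj : Measurable c.proj := c.continuous_proj.measurable
  calc ∫⁻ z in s, h (c.proj z) ∂volume.restrict c.region
      ≤ ∫⁻ z in c.proj ⁻¹' K, h (c.proj z) ∂volume.restrict c.region := lintegral_mono_set hs
    _ = ∫⁻ x in K, h x ∂(volume.restrict c.region).map c.proj :=
        (setLIntegral_map hK hh hproj).symm
    _ ≤ ∫⁻ x in K, h x ∂c.multiplicity • volume :=
        lintegral_mono' (Measure.restrict_mono subset_rfl c.map_proj_le) le_rfl
    _ = c.multiplicity * ∫⁻ x in K, h x := by
        rw [Measure.restrict_smul, lintegral_smul_measure, ENNReal.smul_def, smul_eq_mul]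

theorem lintegral_proj_le {h : X → ℝ≥0∞} (hh : Measurable h) :
    ∫⁻ z in c.region, h (c.proj z) ≤ c.multiplicity * ∫⁻ x, h x := by
  simpa using c.setLIntegral_proj_le hh .univ (mapsTo_univ c.proj univ)

theorem isFiniteMeasureOnCompacts_withDensity [T2Space X] {h : X → ℝ≥0∞} (hh : Measurable h)
    (hloc : ∀ K, IsCompact K → ∫⁻ x in K, h x < ∞) :
    IsFiniteMeasureOnCompacts ((volume.restrict c.region).withDensity fun z => h (c.proj z)) := by
  have hproj : Measurable c.proj := c.continuous_proj.measurable
  refine ⟨fun s hs => ?_⟩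
  have hK : IsCompact (c.proj '' s) := hs.image c.continuous_proj
  calc (volume.restrict c.region).withDensity (fun z => h (c.proj z)) s
      ≤ (volume.restrict c.region).withDensity (fun z => h (c.proj z)) (c.proj ⁻¹' (c.proj '' s)) :=
        measure_mono (subset_preimage_image c.proj s)
    _ = ∫⁻ z in c.proj ⁻¹' (c.proj '' s), h (c.proj z) ∂volume.restrict c.region :=
        withDensity_apply _ (hproj hK.measurableSet)
    _ ≤ c.multiplicity * ∫⁻ x in c.proj '' s, h x :=
        c.setLIntegral_proj_le hh hK.measurableSet (mapsTo_preimage _ _)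
    _ < ∞ := ENNReal.mul_lt_top ENNReal.coe_lt_top (hloc _ hK)

end Basic

section Maximal

variable {X E : Type*} [TopologicalSpace X] [T2Space X] [MeasureSpace X] [BorelSpace X]
  [NormedAddCommGroup E] [NormedSpace ℝ E] [FiniteDimensional ℝ E] [MeasureSpace E] [BorelSpace E]
  [IsFiniteMeasureOnCompacts (volume : Measure E)] {R : ℝ} (c : EuclideanCover X E R)

theorem mul_volume_lt_maximal_le {h : X → ℝ≥0∞} (hh : Measurable h) (ρ : ℝ) (t : ℝ≥0∞) :
    t * volume (c.lift ⁻¹' ball 0 ρ ∩ {x | t < c.maximal h x}) ≤ Besicovitch.multiplicity E *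
      (c.multiplicity * ∫⁻ x in c.proj '' closedBall 0 (ρ + R), h x) := by
  have hK : IsCompact (c.proj '' closedBall 0 (ρ + R)) :=
    (isCompact_closedBall 0 (ρ + R)).image c.continuous_proj
  set M := centeredMaximal (volume.restrict c.region) R fun z => h (c.proj z) with hM
  have hpreimage : c.lift ⁻¹' ball 0 ρ ∩ {x | t < c.maximal h x} =
      c.lift ⁻¹' (ball 0 ρ ∩ {z | t < M z}) := by
    simp only [maximal_eq_centeredMaximal_restrict, preimage_inter, preimage_ofPred_eq, hM]
  have hset : MeasurableSet (ball 0 ρ ∩ {z | t < M z}) :=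
    measurableSet_ball.inter (measurableSet_lt measurable_const (measurable_centeredMaximal _ _ _))
  have hball : ∀ z ∈ ball (0 : E) ρ, ball z R ⊆ closedBall 0 (ρ + R) := fun z hz =>
    (ball_subset_ball' (by linarith [mem_ball.1 hz])).trans ball_subset_closedBall
  calc t * volume (c.lift ⁻¹' ball 0 ρ ∩ {x | t < c.maximal h x})
      ≤ t * volume.restrict c.region (ball 0 ρ ∩ {z | t < M z}) := by
        rw [hpreimage]
        exact mul_le_mul_right (c.volume_lift_preimage_le hset) t
    _ ≤ Besicovitch.multiplicity E *
          ∫⁻ z in closedBall 0 (ρ + R), h (c.proj z) ∂volume.restrict c.region :=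
        mul_meas_lt_centeredMaximal_le hball t
    _ ≤ _ := by
        gcongr
        exact c.setLIntegral_proj_le hh hK.measurableSet (mapsTo_image _ _)

theorem ae_maximal_lt_top {h : X → ℝ≥0∞} (hh : Measurable h)
    (hloc : ∀ K, IsCompact K → ∫⁻ x in K, h x < ∞) : ∀ᵐ x, c.maximal h x < ∞ := by
  have hball : ∀ k : ℕ, volume (c.lift ⁻¹' ball 0 k ∩ {x | c.maximal h x = ∞}) = 0 := by
    intro k
    have hK := hloc _ ((isCompact_closedBall 0 (k + R)).image c.continuous_proj)
    refine eq_zero_of_forall_nat_mul_le (b := Besicovitch.multiplicity E *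
      (c.multiplicity * ∫⁻ x in c.proj '' closedBall 0 (k + R), h x)) (by finiteness)
      fun n => le_trans ?_ (c.mul_volume_lt_maximal_le hh k n)
    gcongr with x
    rintro (hx : _ = _)
    simp [hx]
  refine measure_mono_null (fun x hx => ?_) (measure_iUnion_null hball)
  obtain ⟨k, hk⟩ := exists_nat_gt (dist (c.lift x) 0)
  exact mem_iUnion.2 ⟨k, mem_ball.2 hk, by simpa using hx⟩

theorem lintegral_maximal_rpow_mul_le {σ g : X → ℝ≥0∞} (hσ : Measurable σ) (hg : Measurable g)
    (hloc : ∀ K, IsCompact K → ∫⁻ x in K, σ x < ∞) {p : ℝ} (hp : 1 < p) :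
    ∫⁻ x, c.maximal (fun y => σ y * g y) x ^ p * (σ x / (1 + c.maximal σ x) ^ p) ≤
      strongTypeConst E p * (c.multiplicity * ∫⁻ x, σ x * g x ^ p) := by
  have hp0 : 0 ≤ p := by linarith
  have hproj : Measurable c.proj := c.continuous_proj.measurable
  have hσproj : Measurable fun z => σ (c.proj z) := hσ.comp hproj
  have hgproj : Measurable fun z => g (c.proj z) := hg.comp hproj
  set ν := (volume.restrict c.region).withDensity fun z => σ (c.proj z)
  have : IsFiniteMeasureOnCompacts ν := c.isFiniteMeasureOnCompacts_withDensity hσ hloc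
  set M := centeredMaximal ν R fun z => g (c.proj z)
  have hM : Measurable M := measurable_centeredMaximal _ _ _
  have hpoint : ∀ x, c.maximal (fun y => σ y * g y) x ^ p * (σ x / (1 + c.maximal σ x) ^ p) ≤
      σ (c.proj (c.lift x)) * M (c.lift x) ^ p := by
    intro x
    have hmul : c.maximal (fun y => σ y * g y) x ≤ M (c.lift x) * c.maximal σ x := by
      simp only [maximal_eq_centeredMaximal_restrict]
      exact centeredMaximal_mul_le hσproj hgproj
    rw [c.proj_lift]
    refine le_trans ?_ (mul_rpow_mul_div_one_add_rpow_le hp0 (M (c.lift x)) (c.maximal σ x) (σ x))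
    gcongr
  calc ∫⁻ x, c.maximal (fun y => σ y * g y) x ^ p * (σ x / (1 + c.maximal σ x) ^ p)
      ≤ ∫⁻ x, σ (c.proj (c.lift x)) * M (c.lift x) ^ p := lintegral_mono hpoint
    _ ≤ ∫⁻ z in c.region, σ (c.proj z) * M z ^ p :=
        c.lintegral_lift_le (hσproj.mul (hM.pow_const p))
    _ = ∫⁻ z, M z ^ p ∂ν := (lintegral_withDensity_eq_lintegral_mul _ hσproj (hM.pow_const p)).symm
    _ ≤ strongTypeConst E p * ∫⁻ z, g (c.proj z) ^ p ∂ν :=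
        lintegral_centeredMaximal_rpow_le hgproj hp
    _ = strongTypeConst E p * ∫⁻ z in c.region, σ (c.proj z) * g (c.proj z) ^ p := by
        rw [lintegral_withDensity_eq_lintegral_mul _ hσproj (hgproj.pow_const p)]; rfl
    _ ≤ _ := by
        gcongr
        exact c.lintegral_proj_le (hσ.mul (hg.pow_const p))

end Maximal

section LowerBound

variable {X E : Type*} [TopologicalSpace X] [MeasureSpace X] [BorelSpace X]
  [NormedAddCommGroup E] [MeasureSpace E] [BorelSpace E]
  [(volume : Measure E).IsAddHaarMeasure] {R : ℝ} (c : EuclideanCover X E R)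

theorem le_maximal {h : X → ℝ≥0∞} (hh : Measurable h) {z : E} {x : X}
    (hx : c.lift x ∈ ball z (R / 2)) :
    (volume (ball (0 : E) R))⁻¹ * ∫⁻ y in c.lift ⁻¹' ball z (R / 2), h y ≤ c.maximal h x := by
  have hproj : Measurable c.proj := c.continuous_proj.measurable
  have hsub : ball z (R / 2) ⊆ ball (c.lift x) R :=
    ball_subset_ball' (by linarith [mem_ball'.1 hx])
  calc (volume (ball (0 : E) R))⁻¹ * ∫⁻ y in c.lift ⁻¹' ball z (R / 2), h y
      = (volume (ball (c.lift x) R))⁻¹ *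
          ∫⁻ y, (ball z (R / 2)).indicator (fun w => h (c.proj w)) (c.lift y) := by
        rw [Measure.addHaar_ball_center volume (c.lift x),
          ← lintegral_indicator (c.measurable_lift measurableSet_ball)]
        simp only [indicator, mem_preimage, c.proj_lift]
        rfl
    _ ≤ (volume (ball (c.lift x) R))⁻¹ *
          ∫⁻ w in c.region, (ball z (R / 2)).indicator (fun w => h (c.proj w)) w := by
        gcongr
        exact c.lintegral_lift_le ((hh.comp hproj).indicator measurableSet_ball)
    _ = (volume (ball (c.lift x) R))⁻¹ * ∫⁻ w in ball z (R / 2) ∩ c.region, h (c.proj w) := by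
        rw [lintegral_indicator measurableSet_ball, Measure.restrict_restrict measurableSet_ball]
    _ ≤ (volume (ball (c.lift x) R))⁻¹ * ∫⁻ w in ball (c.lift x) R, h (c.proj w) := by
        gcongr
        exact inter_subset_left.trans hsub
    _ ≤ c.maximal h x := le_iSup₂_of_le R ⟨c.radius_pos, le_rfl⟩ le_rfl

end LowerBound

end EuclideanCover

section Weights

variable {X : Type*} [MeasureSpace X]

theorem IsPosWeight.exists_measurable_pos {v : X → ℝ} (hv : IsPosWeight v) :
    ∃ w : X → ℝ, Measurable w ∧ (∀ x, 0 < w x) ∧ v =ᵐ[volume] w := by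
  have hm := hv.1.measurable_mk
  refine ⟨fun x => if 0 < hv.1.mk v x then hv.1.mk v x else 1,
    Measurable.ite (measurableSet_lt measurable_const hm) hm measurable_const, fun x => ?_, ?_⟩
  · dsimp only
    split_ifs with h
    exacts [h, one_pos]
  · filter_upwards [hv.1.ae_eq_mk, hv.2] with x hx hpos
    rw [← hx, if_pos hpos]

theorem isPosWeight_toReal {φ : X → ℝ≥0∞} (hφ : Measurable φ) (hpos : ∀ᵐ x, φ x ≠ 0)
    (hfin : ∀ x, φ x ≠ ∞) : IsPosWeight fun x => (φ x).toReal :=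
  ⟨hφ.ennreal_toReal.aemeasurable, hpos.mono fun x hx => ENNReal.toReal_pos hx (hfin x)⟩

theorem IsPosWeight.setLIntegral_ne_zero {u : X → ℝ} (hu : IsPosWeight u) {U : Set X}
    (hU : volume U ≠ 0) : ∫⁻ x in U, ENNReal.ofReal (u x) ≠ 0 := by
  intro h0
  rw [lintegral_eq_zero_iff' hu.1.ennreal_ofReal.restrict] at h0
  refine hU (Measure.restrict_eq_zero.1 (ae_eq_bot.1 (Filter.eventually_false_iff_eq_bot.1 ?_)))
  filter_upwards [h0, ae_restrict_of_ae hu.2] with x hx hx'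
  exact (ENNReal.ofReal_pos.2 hx').ne' hx

section Congr

variable {v w : X → ℝ} (h : v =ᵐ[volume] w)

include h

theorem weightedNorm_congr_weight {ε : Type*} [ENorm ε] (p : ℝ) (g : X → ε) :
    weightedNorm p v g = weightedNorm p w g := by
  unfold weightedNorm
  rw [lintegral_congr_ae (h.mono fun x hx => by rw [hx])]

theorem memWeightedLp_congr_weight {ε : Type*} [TopologicalSpace ε] [ENorm ε] (p : ℝ) (g : X → ε) :
    MemWeightedLp p v g ↔ MemWeightedLp p w g := by
  rw [MemWeightedLp, MemWeightedLp, weightedNorm_congr_weight h]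

variable (T : (X → ℂ) → X → ℝ≥0∞) (u : X → ℝ)

theorem mapsStrong_congr_weight (p : ℝ) : MapsStrong T p v u ↔ MapsStrong T p w u := by
  simp only [MapsStrong, memWeightedLp_congr_weight h, weightedNorm_congr_weight h]

theorem mapsIntoWeak_congr_weight : MapsIntoWeak T v u ↔ MapsIntoWeak T w u := by
  simp only [MapsIntoWeak, memWeightedLp_congr_weight h]

theorem mapsWeakBounded_congr_weight : MapsWeakBounded T v u ↔ MapsWeakBounded T w u := by
  simp only [MapsWeakBounded, memWeightedLp_congr_weight h, weightedNorm_congr_weight h]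

end Congr

theorem weightedNorm_one {ε : Type*} [ENorm ε] (w : X → ℝ) (g : X → ε) :
    weightedNorm 1 w g = ∫⁻ x, ‖g x‖ₑ * ENNReal.ofReal (w x) := by
  simp only [weightedNorm, ENNReal.rpow_one, div_one]

theorem MapsWeakBounded.mapsIntoWeak {T : (X → ℂ) → X → ℝ≥0∞} {v u : X → ℝ}
    (h : MapsWeakBounded T v u) : MapsIntoWeak T v u := by
  obtain ⟨C, hC⟩ := h
  refine fun f hf => ⟨(hC f hf).1, C * (weightedNorm 1 v f).toNNReal, fun t ht => ?_⟩
  rw [ENNReal.coe_mul, ENNReal.coe_toNNReal hf.2.ne]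
  exact (hC f hf).2 t ht

theorem mapsStrong_of_lintegral_le {T : (X → ℂ) → X → ℝ≥0∞} {p : ℝ} (hp : 0 < p) {v u : X → ℝ}
    (hT : ∀ f, AEStronglyMeasurable (T f) volume) {A : ℝ≥0∞} (hA : A ≠ ∞)
    (h : ∀ f, AEStronglyMeasurable f volume → ∫⁻ x, T f x ^ p * ENNReal.ofReal (u x) ≤
      A * ∫⁻ x, ‖f x‖ₑ ^ p * ENNReal.ofReal (v x)) : MapsStrong T p v u := by
  have hApow : A ^ (1 / p) ≠ ∞ := ENNReal.rpow_ne_top_of_nonneg (by positivity) hA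
  refine ⟨(A ^ (1 / p)).toNNReal, fun f hf => ?_⟩
  have hnorm : weightedNorm p u (T f) ≤ (A ^ (1 / p)).toNNReal * weightedNorm p v f := by
    rw [ENNReal.coe_toNNReal hApow, weightedNorm, weightedNorm,
      ← ENNReal.mul_rpow_of_nonneg _ _ (by positivity)]
    exact ENNReal.rpow_le_rpow (h f hf.1) (by positivity)
  exact ⟨⟨hT f, hnorm.trans_lt (ENNReal.mul_lt_top ENNReal.coe_lt_top hf.2)⟩, hnorm⟩

theorem exists_mapsWeakBounded_of_exhaustion {T : (X → ℂ) → X → ℝ≥0∞} {v : X → ℝ}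
    (hT : ∀ f, AEStronglyMeasurable (T f) volume) {S : ℕ → Set X} (hS : ∀ k, MeasurableSet (S k))
    (hcover : ∀ x, ∃ k, x ∈ S k) {C : ℕ → ℝ≥0∞} (hC : ∀ k, C k ≠ ∞)
    (h : ∀ f, AEStronglyMeasurable f volume → ∀ (k : ℕ) (t : ℝ≥0∞),
      t * volume (S k ∩ {x | t < T f x}) ≤ C k * ∫⁻ x, ‖f x‖ₑ * ENNReal.ofReal (v x)) :
    ∃ u : X → ℝ, IsPosWeight u ∧ MapsWeakBounded T v u := by
  obtain ⟨δ, hδpos, hδ⟩ := ENNReal.exists_pos_tsum_mul_lt_of_countable one_ne_zero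
    (fun k => C k + 1) fun k => ENNReal.add_ne_top.2 ⟨hC k, ENNReal.one_ne_top⟩
  set φ : X → ℝ≥0∞ := fun x => ∑' k, (S k).indicator (fun _ => (δ k : ℝ≥0∞)) x
  have hφ : Measurable φ := .tsum fun k => measurable_const.indicator (hS k)
  have hφpos : ∀ x, φ x ≠ 0 := by
    intro x hx
    obtain ⟨k, hk⟩ := hcover x
    have hk0 := ENNReal.tsum_eq_zero.1 hx k
    rw [indicator_of_mem hk] at hk0
    exact (hδpos k).ne' (by exact_mod_cast hk0)
  have hφfin : ∀ x, φ x ≠ ∞ := fun x => ne_top_of_le_ne_top (hδ.trans ENNReal.one_lt_top).ne <|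
    ENNReal.tsum_le_tsum fun k => (indicator_le_self _ _ x).trans <|
      le_mul_of_one_le_left' le_add_self
  refine ⟨_, isPosWeight_toReal hφ (.of_forall hφpos) hφfin, 1, fun f hf => ⟨hT f, fun t ht => ?_⟩⟩
  rw [ENNReal.le_div_iff_mul_le (.inl (by exact_mod_cast ht.ne')) (.inl ENNReal.coe_ne_top),
    ENNReal.coe_one, one_mul, weightedNorm_one, weightedDistrib, mul_comm]
  set I := ∫⁻ x, ‖f x‖ₑ * ENNReal.ofReal (v x)
  simp only [enorm_eq_self, ENNReal.ofReal_toReal (hφfin _)]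
  calc t * ∫⁻ x in {x | t < T f x}, φ x
      = ∑' k, δ k * (t * volume (S k ∩ {x | t < T f x})) := by
        rw [lintegral_tsum fun k => (measurable_const.indicator (hS k)).aemeasurable,
          ← ENNReal.tsum_mul_left]
        refine tsum_congr fun k => ?_
        rw [lintegral_indicator_const (hS k), Measure.restrict_apply (hS k)]
        ring
    _ ≤ ∑' k, (C k + 1) * δ k * I := ENNReal.tsum_le_tsum fun k => by
        calc δ k * (t * volume (S k ∩ {x | t < T f x})) ≤ δ k * (C k * I) := by
              exact mul_le_mul_right (h f hf.1 k t) _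
          _ ≤ δ k * ((C k + 1) * I) := by gcongr; exact le_self_add
          _ = (C k + 1) * δ k * I := by ring
    _ ≤ I := by
        rw [ENNReal.tsum_mul_right]
        exact mul_le_of_le_one_left' hδ.le

end Weights

section DualWeight

variable {X : Type*}

/-- The dual weight `w^{-1/(p-1)} = w^{1-p'}` of the weight `w` for the exponent `p`. -/
noncomputable def dualWeight (p : ℝ) (w : X → ℝ) (x : X) : ℝ≥0∞ :=
  ENNReal.ofReal (w x) ^ (-(1 / (p - 1)))

theorem measurable_dualWeight [MeasurableSpace X] {w : X → ℝ} (hw : Measurable w) (p : ℝ) :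
    Measurable (dualWeight p w) :=
  hw.ennreal_ofReal.pow_const _

variable {p : ℝ} {w : X → ℝ} {x : X}

theorem dualWeight_ne_zero (hx : 0 < w x) : dualWeight p w x ≠ 0 :=
  (ENNReal.rpow_pos (ENNReal.ofReal_pos.2 hx) ENNReal.ofReal_ne_top).ne'

theorem dualWeight_ne_top (hx : 0 < w x) : dualWeight p w x ≠ ∞ := by
  simp [dualWeight, ENNReal.rpow_eq_top_iff, hx]

theorem dualWeight_rpow_mul (hp : 1 < p) (hx : 0 < w x) :
    dualWeight p w x ^ p * ENNReal.ofReal (w x) = dualWeight p w x := by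
  have hexp : -(1 / (p - 1)) * p + 1 = -(1 / (p - 1)) := by
    have : p - 1 ≠ 0 := by linarith
    field_simp
    ring
  calc dualWeight p w x ^ p * ENNReal.ofReal (w x)
      = ENNReal.ofReal (w x) ^ (-(1 / (p - 1)) * p + 1) := by
        rw [ENNReal.rpow_add _ _ (ENNReal.ofReal_pos.2 hx).ne' ENNReal.ofReal_ne_top,
          ENNReal.rpow_mul, ENNReal.rpow_one, dualWeight]
    _ = dualWeight p w x := by rw [hexp, dualWeight]

theorem dualWeight_mul_div_rpow (hp : 1 < p) (hx : 0 < w x) (a : ℝ≥0∞) :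
    dualWeight p w x * (a / dualWeight p w x) ^ p = a ^ p * ENNReal.ofReal (w x) := by
  have hp0 : 0 ≤ p := by linarith
  have hpow : dualWeight p w x ^ p ≠ 0 :=
    (ENNReal.rpow_pos (dualWeight_ne_zero hx).bot_lt (dualWeight_ne_top hx)).ne'
  have hpow' : dualWeight p w x ^ p ≠ ∞ := ENNReal.rpow_ne_top_of_nonneg hp0 (dualWeight_ne_top hx)
  calc dualWeight p w x * (a / dualWeight p w x) ^ p
      = dualWeight p w x ^ p * ENNReal.ofReal (w x) * (a ^ p / dualWeight p w x ^ p) := by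
        rw [dualWeight_rpow_mul hp hx, ENNReal.div_rpow_of_nonneg _ _ hp0]
    _ = dualWeight p w x ^ p * (a ^ p / dualWeight p w x ^ p) * ENNReal.ofReal (w x) := by ring
    _ = a ^ p * ENNReal.ofReal (w x) := by rw [ENNReal.mul_div_cancel hpow hpow']

end DualWeight

namespace EuclideanCover

open Metric

section Operator

variable {X E : Type*} [TopologicalSpace X] [MeasureSpace X] [PseudoMetricSpace E] [MeasureSpace E]
  {R : ℝ} (c : EuclideanCover X E R)

/-- The local maximal operator of the cover, acting on complex functions; for `𝕋ⁿ` this is `M^T`. -/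
noncomputable def maximalOperator (f : X → ℂ) : X → ℝ≥0∞ :=
  c.maximal fun x => ‖f x‖ₑ

theorem aestronglyMeasurable_maximalOperator [ProperSpace E] [OpensMeasurableSpace E]
    [IsFiniteMeasureOnCompacts (volume : Measure E)] (f : X → ℂ) :
    AEStronglyMeasurable (c.maximalOperator f) volume :=
  (c.measurable_maximal _).aestronglyMeasurable

end Operator

section Sufficiency

variable {X E : Type*} [TopologicalSpace X] [T2Space X] [MeasureSpace X] [BorelSpace X]
  [NormedAddCommGroup E] [NormedSpace ℝ E] [FiniteDimensional ℝ E] [MeasureSpace E] [BorelSpace E]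
  [IsFiniteMeasureOnCompacts (volume : Measure E)] {R : ℝ} (c : EuclideanCover X E R)

theorem exists_mapsStrong {w : X → ℝ} (hw : Measurable w) (hpos : ∀ x, 0 < w x) {p : ℝ} (hp : 1 < p)
    (hloc : ∀ K, IsCompact K → ∫⁻ x in K, dualWeight p w x < ∞) :
    ∃ u : X → ℝ, IsPosWeight u ∧ MapsStrong c.maximalOperator p w u := by
  have hp0 : 0 < p := by linarith
  set σ := dualWeight p w
  have hσ : Measurable σ := measurable_dualWeight hw p
  set φ : X → ℝ≥0∞ := fun x => σ x / (1 + c.maximal σ x) ^ p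
  have hφ : Measurable φ :=
    hσ.div ((measurable_const.add (c.measurable_maximal σ)).pow_const p)
  have hφpos : ∀ᵐ x, φ x ≠ 0 := (c.ae_maximal_lt_top hσ hloc).mono fun x hx =>
    ENNReal.div_ne_zero.2 ⟨dualWeight_ne_zero (hpos x), by finiteness⟩
  have hφfin : ∀ x, φ x ≠ ∞ := fun x =>
    ENNReal.div_ne_top (dualWeight_ne_top (hpos x)) (by positivity)
  refine ⟨_, isPosWeight_toReal hφ hφpos hφfin, mapsStrong_of_lintegral_le hp0
    c.aestronglyMeasurable_maximalOperator (A := strongTypeConst E p * c.multiplicity)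
    (ENNReal.mul_ne_top (strongTypeConst_ne_top E hp) ENNReal.coe_ne_top) fun f hf => ?_⟩
  set g := hf.enorm.mk fun x => ‖f x‖ₑ
  have hg : Measurable g := hf.enorm.measurable_mk
  have hfg : ∀ᵐ x, ‖f x‖ₑ = g x := hf.enorm.ae_eq_mk
  have hfσ : (fun x => ‖f x‖ₑ) =ᵐ[volume] fun x => σ x * (g x / σ x) :=
    hfg.mono fun x hx => hx.trans
      (ENNReal.mul_div_cancel (dualWeight_ne_zero (hpos x)) (dualWeight_ne_top (hpos x))).symm
  simp only [ENNReal.ofReal_toReal (hφfin _)]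
  calc ∫⁻ x, c.maximalOperator f x ^ p * φ x
      = ∫⁻ x, c.maximal (fun y => σ y * (g y / σ y)) x ^ p * φ x := by
        rw [maximalOperator, c.maximal_congr hfσ]
    _ ≤ strongTypeConst E p * (c.multiplicity * ∫⁻ x, σ x * (g x / σ x) ^ p) :=
        c.lintegral_maximal_rpow_mul_le hσ (hg.div hσ) hloc hp
    _ = strongTypeConst E p * c.multiplicity * ∫⁻ x, ‖f x‖ₑ ^ p * ENNReal.ofReal (w x) := by
        rw [mul_assoc, lintegral_congr_ae (hfg.mono fun x hx => ?_)]
        rw [dualWeight_mul_div_rpow hp (hpos x), hx]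

theorem exists_mapsWeakBounded {w : X → ℝ}
    (hloc : ∀ K : Set X, IsCompact K →
      ∃ B : ℝ≥0, ∀ᵐ x ∂volume.restrict K, 1 ≤ B * ENNReal.ofReal (w x)) :
    ∃ u : X → ℝ, IsPosWeight u ∧ MapsWeakBounded c.maximalOperator w u := by
  have hK : ∀ k : ℕ, IsCompact (c.proj '' closedBall 0 (k + R)) := fun k =>
    (isCompact_closedBall 0 (k + R)).image c.continuous_proj
  choose B hB using fun k => hloc _ (hK k)
  refine exists_mapsWeakBounded_of_exhaustion c.aestronglyMeasurable_maximalOperator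
    (S := fun k => c.lift ⁻¹' ball 0 k) (fun k => c.measurable_lift measurableSet_ball)
    (fun x => ?_) (C := fun k => Besicovitch.multiplicity E * (c.multiplicity * B k))
    (fun k => by finiteness) fun f hf k t => ?_
  · obtain ⟨k, hk⟩ := exists_nat_gt (dist (c.lift x) 0)
    exact ⟨k, mem_ball.2 hk⟩
  · set g := hf.enorm.mk fun x => ‖f x‖ₑ
    have hg : Measurable g := hf.enorm.measurable_mk
    have hfg : ∀ᵐ x, ‖f x‖ₑ = g x := hf.enorm.ae_eq_mk
    have hgw : ∫⁻ x in c.proj '' closedBall 0 (k + R), g x ≤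
        B k * ∫⁻ x, ‖f x‖ₑ * ENNReal.ofReal (w x) := by
      calc ∫⁻ x in c.proj '' closedBall 0 (k + R), g x
          ≤ ∫⁻ x in c.proj '' closedBall 0 (k + R), B k * (g x * ENNReal.ofReal (w x)) :=
            lintegral_mono_ae <| (hB k).mono fun x hx => by
              rw [mul_left_comm]
              exact le_mul_of_one_le_right' hx
        _ ≤ ∫⁻ x, B k * (g x * ENNReal.ofReal (w x)) := setLIntegral_le_lintegral _ _
        _ = B k * ∫⁻ x, ‖f x‖ₑ * ENNReal.ofReal (w x) := by
            rw [lintegral_const_mul' _ _ ENNReal.coe_ne_top,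
              lintegral_congr_ae (hfg.mono fun x hx => by rw [← hx])]
    rw [maximalOperator, c.maximal_congr hfg, mul_assoc, mul_assoc]
    refine (c.mul_volume_lt_maximal_le hg k t).trans ?_
    gcongr

end Sufficiency

end EuclideanCover

section Necessity

theorem le_rpow_of_le_mul_rpow {p : ℝ} (hp : 1 < p) {a C : ℝ≥0∞} (ha : a ≠ ∞)
    (h : a ≤ C * a ^ (1 / p)) : a ≤ C ^ (p / (p - 1)) := by
  rcases eq_or_ne a 0 with rfl | ha0
  · exact zero_le
  have hp1 : 0 < p - 1 := by linarith
  have hp0 : 0 < p := by linarith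
  have hroot : a ^ (1 / p) ≠ 0 := (ENNReal.rpow_pos ha0.bot_lt ha).ne'
  have hroot' : a ^ (1 / p) ≠ ∞ := ENNReal.rpow_ne_top_of_nonneg (by positivity) ha
  have hle : a ^ ((p - 1) / p) ≤ C := by
    rw [← ENNReal.mul_le_mul_iff_left hroot hroot', ← ENNReal.rpow_add _ _ ha0 ha, ← add_div,
      sub_add_cancel, div_self hp0.ne', ENNReal.rpow_one]
    exact h
  calc a = (a ^ ((p - 1) / p)) ^ (p / (p - 1)) := by
        rw [← ENNReal.rpow_mul, div_mul_div_cancel₀ hp0.ne', div_self hp1.ne', ENNReal.rpow_one]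
    _ ≤ C ^ (p / (p - 1)) := ENNReal.rpow_le_rpow hle (by positivity)

/-- Otherwise there are `s k` with `2 ^ k * ν (s k) < μ (s k)`, and the sum of the functions
`1_{s k} / μ (s k)` is `ν`-integrable but not `μ`-integrable. -/
theorem exists_le_smul_of_lintegral_ne_top {α : Type*} [MeasurableSpace α] {μ ν : Measure α}
    (h : ∀ φ : α → ℝ≥0∞, Measurable φ → ∫⁻ x, φ x ∂ν ≠ ∞ → ∫⁻ x, φ x ∂μ ≠ ∞) :
    ∃ C : ℝ≥0, μ ≤ C • ν := by
  by_contra! hcon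
  simp only [Measure.le_iff, not_forall, not_le] at hcon
  choose s hs hlt using fun k : ℕ => hcon (2 ^ k)
  replace hlt : ∀ k, 2 ^ k * ν (s k) < μ (s k) := fun k => by
    simpa [ENNReal.smul_def] using hlt k
  have hν : ∀ k, ν (s k) ≠ ∞ := fun k htop => by
    simpa [htop, ENNReal.mul_top] using hlt k
  have hμ0 : ∀ k, μ (s k) ≠ 0 := fun k => (zero_le.trans_lt (hlt k)).ne'
  have hμ : ∀ k, μ (s k) ≠ ∞ := fun k => by
    simpa [hs k] using
      h ((s k).indicator 1) (measurable_one.indicator (hs k)) (by simp [hs k, hν k])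
  set φ : α → ℝ≥0∞ := fun x => ∑' k, (s k).indicator (fun _ => (μ (s k))⁻¹) x with hφ
  have hφm : ∀ k, Measurable ((s k).indicator fun _ => (μ (s k))⁻¹) := fun k =>
    measurable_const.indicator (hs k)
  have hint : ∀ ρ : Measure α, ∫⁻ x, φ x ∂ρ = ∑' k, (μ (s k))⁻¹ * ρ (s k) := fun ρ => by
    rw [hφ, lintegral_tsum fun k => (hφm k).aemeasurable]
    simp only [lintegral_indicator_const (hs _)]
  refine h φ (.tsum hφm) ?_ ?_
  · have hterm : ∀ k, (μ (s k))⁻¹ * ν (s k) ≤ 2⁻¹ ^ k := by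
      intro k
      rw [mul_comm, ← div_eq_mul_inv]
      refine ENNReal.div_le_of_le_mul ?_
      rw [← ENNReal.inv_pow, mul_comm, ← div_eq_mul_inv,
        ENNReal.le_div_iff_mul_le (.inl (by positivity)) (.inl (by finiteness)), mul_comm]
      exact (hlt k).le
    rw [hint]
    refine ne_top_of_le_ne_top ?_ (ENNReal.tsum_le_tsum hterm)
    rw [ENNReal.tsum_geometric]
    simp
  · simp only [hint, ENNReal.inv_mul_cancel (hμ0 _) (hμ _)]
    exact ENNReal.tsum_const_eq_top_of_ne_zero one_ne_zero

variable {X : Type*} [MeasureSpace X]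

theorem exists_measurable_enorm_ae_eq {φ : X → ℝ≥0∞} (hφ : Measurable φ)
    (hfin : ∀ᵐ x, φ x ≠ ∞) : ∃ f : X → ℂ, Measurable f ∧ ∀ᵐ x, ‖f x‖ₑ = φ x := by
  refine ⟨fun x => ((φ x).toReal : ℂ), Complex.measurable_ofReal.comp hφ.ennreal_toReal,
    hfin.mono fun x hx => ?_⟩
  rw [← ofReal_norm, Complex.norm_real, Real.norm_of_nonneg ENNReal.toReal_nonneg,
    ENNReal.ofReal_toReal hx]

theorem setLIntegral_dualWeight_le {v : X → ℝ} (hv : Measurable v) (hpos : ∀ x, 0 < v x) {p : ℝ}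
    (hp : 1 < p) {U : Set X} {A : ℝ≥0∞} (hA : ∀ f : X → ℂ, Measurable f → weightedNorm p v f < ∞ →
      ∫⁻ x in U, ‖f x‖ₑ ≤ A * weightedNorm p v f)
    {V : Set X} (hVU : V ⊆ U) (hV : MeasurableSet V) (hfin : ∫⁻ x in V, dualWeight p v x ≠ ∞) :
    ∫⁻ x in V, dualWeight p v x ≤ A ^ (p / (p - 1)) := by
  have hp0 : 0 < p := by linarith
  obtain ⟨f, hf, hfσ⟩ := exists_measurable_enorm_ae_eq
    ((measurable_dualWeight hv p).indicator hV) <| .of_forall fun x =>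
      ne_top_of_le_ne_top (dualWeight_ne_top (hpos x)) (indicator_le_self _ _ x)
  have hnorm : weightedNorm p v f = (∫⁻ x in V, dualWeight p v x) ^ (1 / p) := by
    rw [weightedNorm, ← lintegral_indicator hV]
    congr 1
    refine lintegral_congr_ae (hfσ.mono fun x hx => ?_)
    by_cases hxV : x ∈ V
    · simp only [hx, indicator_of_mem hxV, dualWeight_rpow_mul hp (hpos x)]
    · simp only [hx, indicator_of_notMem hxV, ENNReal.zero_rpow_of_pos hp0, zero_mul]
  have hint : ∫⁻ x in U, ‖f x‖ₑ = ∫⁻ x in V, dualWeight p v x := by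
    rw [lintegral_congr_ae (ae_restrict_of_ae hfσ), lintegral_indicator hV,
      Measure.restrict_restrict_of_subset hVU]
  refine le_rpow_of_le_mul_rpow hp hfin ?_
  rw [← hnorm, ← hint]
  refine hA f hf ?_
  rw [hnorm]
  finiteness

/-- On the set `U` the values of the operator `T` dominate a fixed multiple of the integral over
`U`: the only property of a maximal operator that is used to derive necessary conditions on `v`. -/
def DominatesIntegral (T : (X → ℂ) → X → ℝ≥0∞) (U : Set X) : Prop :=
  ∃ κ : ℝ≥0∞, κ ≠ 0 ∧ ∀ f : X → ℂ, Measurable f → ∀ x ∈ U, κ * ∫⁻ y in U, ‖f y‖ₑ ≤ T f x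

namespace DominatesIntegral

variable {T : (X → ℂ) → X → ℝ≥0∞} {U : Set X} {v u : X → ℝ}

theorem exists_setLIntegral_le_of_mapsStrong (hT : DominatesIntegral T U) (hU : MeasurableSet U)
    (hU0 : volume U ≠ 0) (hu : IsPosWeight u) {p : ℝ} (hp : 0 < p) (h : MapsStrong T p v u) :
    ∃ A : ℝ≥0∞, A ≠ ∞ ∧ ∀ f : X → ℂ, Measurable f → weightedNorm p v f < ∞ →
      ∫⁻ x in U, ‖f x‖ₑ ≤ A * weightedNorm p v f := by
  obtain ⟨κ, hκ, hlow⟩ := hT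
  obtain ⟨C, hC⟩ := h
  set W := (∫⁻ x in U, ENNReal.ofReal (u x)) ^ (1 / p) with hW
  have hκW : κ * W ≠ 0 := mul_ne_zero hκ <| by
    simpa [hW, ENNReal.rpow_eq_zero_iff, hp.not_gt, hp] using hu.setLIntegral_ne_zero hU0
  refine ⟨C / (κ * W), ENNReal.div_ne_top ENNReal.coe_ne_top hκW, fun f hf hfin => ?_⟩
  rw [← ENNReal.mul_div_right_comm, ENNReal.le_div_iff_mul_le (.inl hκW)
    (.inr (ENNReal.mul_ne_top ENNReal.coe_ne_top hfin.ne))]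
  set I := ∫⁻ x in U, ‖f x‖ₑ
  calc I * (κ * W) = ((κ * I) ^ p * ∫⁻ x in U, ENNReal.ofReal (u x)) ^ (1 / p) := by
        rw [ENNReal.mul_rpow_of_nonneg _ _ (by positivity), one_div, ENNReal.rpow_rpow_inv hp.ne',
          ← one_div]
        ring
    _ ≤ (∫⁻ x in U, (κ * I) ^ p * ENNReal.ofReal (u x)) ^ (1 / p) := by
        gcongr
        exact lintegral_const_mul_le _ _
    _ ≤ (∫⁻ x in U, ‖T f x‖ₑ ^ p * ENNReal.ofReal (u x)) ^ (1 / p) := by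
        refine ENNReal.rpow_le_rpow (setLIntegral_mono' hU fun x hx => ?_) (by positivity)
        have := hlow f hf x hx
        rw [enorm_eq_self]
        gcongr
    _ ≤ weightedNorm p u (T f) :=
        ENNReal.rpow_le_rpow (setLIntegral_le_lintegral _ _) (by positivity)
    _ ≤ C * weightedNorm p v f := (hC f ⟨hf.aestronglyMeasurable, hfin⟩).2

theorem setLIntegral_dualWeight_lt_top (hT : DominatesIntegral T U) (hU : MeasurableSet U)
    (hUfin : volume U ≠ ∞) (hv : Measurable v) (hpos : ∀ x, 0 < v x) (hu : IsPosWeight u) {p : ℝ}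
    (hp : 1 < p) (h : MapsStrong T p v u) : ∫⁻ x in U, dualWeight p v x < ∞ := by
  have hp0 : 0 < p := by linarith
  rcases eq_or_ne (volume U) 0 with hU0 | hU0
  · simp [Measure.restrict_eq_zero.2 hU0]
  obtain ⟨A, hA, hbound⟩ := hT.exists_setLIntegral_le_of_mapsStrong hU hU0 hu hp0 h
  set σ := dualWeight p v
  have hσ : Measurable σ := measurable_dualWeight hv p
  set V : ℕ → Set X := fun n => U ∩ {x | σ x ≤ n}
  have hV : ∀ n, MeasurableSet (V n) := fun n => hU.inter (measurableSet_le hσ measurable_const)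
  have hVbound : ∀ n, ∫⁻ x in V n, σ x ≤ A ^ (p / (p - 1)) := fun n =>
    setLIntegral_dualWeight_le hv hpos hp hbound inter_subset_left (hV n)
      (setLIntegral_lt_top_of_le_nnreal (measure_ne_top_of_subset inter_subset_left hUfin)
        ⟨n, fun x hx => by exact_mod_cast hx.2⟩).ne
  have hmono : Monotone V := fun m n hmn x hx =>
    ⟨hx.1, (show σ x ≤ m from hx.2).trans (by exact_mod_cast hmn)⟩
  have hUnion : U = ⋃ n, V n := by
    rw [← inter_iUnion, eq_comm, inter_eq_left]
    intro x _
    obtain ⟨n, hn⟩ := ENNReal.exists_nat_gt (dualWeight_ne_top (p := p) (hpos x))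
    exact mem_iUnion.2 ⟨n, hn.le⟩
  rw [hUnion, setLIntegral_iUnion_of_directed _ hmono.directed_le]
  refine (iSup_le hVbound).trans_lt (ENNReal.rpow_ne_top_of_nonneg ?_ hA).lt_top
  exact div_nonneg hp0.le (by linarith)

theorem setLIntegral_ne_top_of_mapsIntoWeak (hT : DominatesIntegral T U) (hU0 : volume U ≠ 0)
    (hu : IsPosWeight u) (h : MapsIntoWeak T v u) {f : X → ℂ} (hf : Measurable f)
    (hfv : weightedNorm 1 v f < ∞) : ∫⁻ x in U, ‖f x‖ₑ ≠ ∞ := by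
  intro htop
  obtain ⟨κ, hκ, hlow⟩ := hT
  obtain ⟨-, C, hC⟩ := h f ⟨hf.aestronglyMeasurable, hfv⟩
  have hTf : ∀ x ∈ U, T f x = ∞ := fun x hx => by
    simpa [htop, ENNReal.mul_top hκ] using hlow f hf x hx
  refine hu.setLIntegral_ne_zero hU0 (eq_zero_of_forall_nat_mul_le (b := C) ENNReal.coe_ne_top ?_)
  rintro (_ | n)
  · simp
  rw [mul_comm, ← ENNReal.le_div_iff_mul_le (by simp) (by simp)]
  exact (lintegral_mono_set fun x hx => by simp [hTf x hx]).trans (hC (n + 1 : ℕ) (by positivity))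

theorem exists_ae_one_le_mul (hT : DominatesIntegral T U) (hU : MeasurableSet U)
    (hUfin : volume U ≠ ∞) (hv : Measurable v) (hpos : ∀ x, 0 < v x) (hu : IsPosWeight u)
    (h : MapsIntoWeak T v u) :
    ∃ B : ℝ≥0, ∀ᵐ x ∂volume.restrict U, 1 ≤ B * ENNReal.ofReal (v x) := by
  rcases eq_or_ne (volume U) 0 with hU0 | hU0
  · simp [Measure.restrict_eq_zero.2 hU0]
  have : IsFiniteMeasure (volume.restrict U) := isFiniteMeasure_restrict.2 hUfin
  have hV : Measurable fun x => ENNReal.ofReal (v x) := hv.ennreal_ofReal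
  obtain ⟨B, hB⟩ := exists_le_smul_of_lintegral_ne_top (μ := volume.restrict U)
    (ν := volume.withDensity fun x => ENNReal.ofReal (v x)) fun φ hφ hφv => by
      rw [lintegral_withDensity_eq_lintegral_mul _ hV hφ] at hφv
      have hfin : ∀ᵐ x, φ x ≠ ∞ := (ae_lt_top (hV.mul hφ) hφv).mono fun x hx htop => by
        simp [htop, ENNReal.mul_top, hpos x] at hx
      obtain ⟨f, hf, hfφ⟩ := exists_measurable_enorm_ae_eq hφ hfin
      rw [← lintegral_congr_ae (ae_restrict_of_ae hfφ)]
      refine hT.setLIntegral_ne_top_of_mapsIntoWeak hU0 hu h hf ?_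
      rw [weightedNorm_one, lintegral_congr_ae (hfφ.mono fun x hx => by rw [hx, mul_comm])]
      exact hφv.lt_top
  refine ⟨B, ae_le_of_forall_setLIntegral_le_of_sigmaFinite measurable_const fun s hs _ => ?_⟩
  calc ∫⁻ _ in s, 1 ∂volume.restrict U = volume.restrict U (s ∩ U) := by
        rw [setLIntegral_one, Measure.restrict_apply hs, Measure.restrict_apply (hs.inter hU),
          inter_assoc, inter_self]
    _ ≤ B * ∫⁻ x in s ∩ U, ENNReal.ofReal (v x) := by
        rw [← withDensity_apply _ (hs.inter hU)]
        exact hB (s ∩ U)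
    _ = ∫⁻ x in s, B * ENNReal.ofReal (v x) ∂volume.restrict U := by
        rw [Measure.restrict_restrict hs, lintegral_const_mul _ hV]

end DominatesIntegral

end Necessity

section LocalIntegrability

variable {X : Type*} [TopologicalSpace X] [MeasureSpace X] {v w : X → ℝ}

theorem memLocLp_rpow_iff_lintegral (hw : Measurable w) (hpos : ∀ x, 0 < w x)
    (h : v =ᵐ[volume] w) {p p' : ℝ} (hp : 1 < p) (hpp' : 1 / p + 1 / p' = 1) :
    MemLocLp (fun x => v x ^ (-(1 / p))) (ENNReal.ofReal p') ↔
      ∀ K : Set X, IsCompact K → ∫⁻ x in K, dualWeight p w x < ∞ := by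
  have hp1 : p - 1 ≠ 0 := by linarith
  have hp0 : p ≠ 0 := by linarith
  have hconj : p' = p / (p - 1) :=
    (Real.holderConjugate_iff.2 ⟨hp, by simpa only [one_div] using hpp'⟩).conjugate_eq
  have hp' : 0 < p' := hconj ▸ div_pos (by linarith) (by linarith)
  refine forall₂_congr fun K _ => ?_
  have hae : (fun x => v x ^ (-(1 / p))) =ᵐ[volume.restrict K] fun x => w x ^ (-(1 / p)) :=
    ae_restrict_of_ae (h.mono fun x hx => by simp only [hx])
  rw [memLp_congr_ae hae, MemLp, and_iff_right (hw.pow_const _).aestronglyMeasurable,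
    eLpNorm_lt_top_iff_lintegral_rpow_enorm_lt_top (by simpa using hp') ENNReal.ofReal_ne_top,
    ENNReal.toReal_ofReal hp'.le]
  refine iff_of_eq (congrArg (· < ∞) (lintegral_congr fun x => ?_))
  have hexp : -(1 / p) * p' = -(1 / (p - 1)) := by
    rw [hconj]
    field_simp
  rw [Real.enorm_of_nonneg (Real.rpow_pos_of_pos (hpos x) _).le,
    ← ENNReal.ofReal_rpow_of_pos (hpos x), ← ENNReal.rpow_mul, hexp, dualWeight]

theorem memLocLp_inv_iff (hw : Measurable w) (hpos : ∀ x, 0 < w x) (h : v =ᵐ[volume] w) :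
    MemLocLp (fun x => (v x)⁻¹) ∞ ↔ ∀ K : Set X, IsCompact K →
      ∃ B : ℝ≥0, ∀ᵐ x ∂volume.restrict K, 1 ≤ B * ENNReal.ofReal (w x) := by
  refine forall₂_congr fun K _ => ?_
  have hae : (fun x => (v x)⁻¹) =ᵐ[volume.restrict K] fun x => (w x)⁻¹ :=
    ae_restrict_of_ae (h.mono fun x hx => by simp only [hx])
  have hiff : ∀ (B : ℝ≥0) (x : X), ‖(w x)⁻¹‖ₑ ≤ B ↔ 1 ≤ B * ENNReal.ofReal (w x) := by
    intro B x
    rw [Real.enorm_of_nonneg (inv_nonneg.2 (hpos x).le), ENNReal.ofReal_inv_of_pos (hpos x),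
      ← one_div, ENNReal.div_le_iff (ENNReal.ofReal_pos.2 (hpos x)).ne' ENNReal.ofReal_ne_top]
  have hinv : Measurable fun x => (w x)⁻¹ := hw.inv
  rw [memLp_congr_ae hae, MemLp, and_iff_right hinv.aestronglyMeasurable, eLpNorm_exponent_top]
  constructor
  · intro hfin
    refine ⟨(eLpNormEssSup (fun x => (w x)⁻¹) (volume.restrict K)).toNNReal, ?_⟩
    filter_upwards [ae_le_eLpNormEssSup (f := fun x => (w x)⁻¹)] with x hx
    rwa [← hiff, ENNReal.coe_toNNReal hfin.ne]
  · rintro ⟨B, hB⟩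
    exact (essSup_le_of_ae_le _ (hB.mono fun x => (hiff B x).2)).trans_lt ENNReal.coe_lt_top

theorem memLocLp_iff_memLp [CompactSpace X] {f : X → ℝ} {q : ℝ≥0∞} :
    MemLocLp f q ↔ MemLp f q volume :=
  ⟨fun h => by simpa using h univ isCompact_univ, fun h K _ => h.restrict K⟩

end LocalIntegrability

namespace EuclideanCover

open Metric

section LocalPieces

variable {X E : Type*} [TopologicalSpace X] [MeasureSpace X] [NormedAddCommGroup E] [MeasureSpace E]
  {R : ℝ} (c : EuclideanCover X E R)

theorem exists_finite_cover [ProperSpace E] {K : Set X} (hK : IsCompact K) :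
    ∃ t : Set E, t.Finite ∧ K ⊆ ⋃ z ∈ t, c.lift ⁻¹' ball z (R / 2) := by
  obtain ⟨t, ht, hsub⟩ := totallyBounded_iff.1
    ((c.isBounded_lift K hK).isCompact_closure.totallyBounded.subset subset_closure)
    (R / 2) (half_pos c.radius_pos)
  refine ⟨t, ht, fun x hx => ?_⟩
  obtain ⟨z, hz, hxz⟩ := mem_iUnion₂.1 (hsub (mem_image_of_mem c.lift hx))
  exact mem_iUnion₂.2 ⟨z, hz, hxz⟩

variable [BorelSpace E]

theorem measurableSet_lift_preimage_ball (z : E) (ρ : ℝ) :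
    MeasurableSet (c.lift ⁻¹' ball z ρ) :=
  c.measurable_lift measurableSet_ball

theorem volume_lift_preimage_ball_ne_top [ProperSpace E]
    [IsFiniteMeasureOnCompacts (volume : Measure E)] (z : E) (ρ : ℝ) :
    volume (c.lift ⁻¹' ball z ρ) ≠ ∞ :=
  ((c.volume_lift_preimage_le measurableSet_ball).trans
    (Measure.restrict_apply_le _ _)).trans_lt measure_ball_lt_top |>.ne

variable [BorelSpace X] [ProperSpace E] [(volume : Measure E).IsAddHaarMeasure] {w u : X → ℝ}

theorem dominatesIntegral_maximalOperator (z : E) :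
    DominatesIntegral c.maximalOperator (c.lift ⁻¹' ball z (R / 2)) :=
  ⟨(volume (ball (0 : E) R))⁻¹, ENNReal.inv_ne_zero.2 measure_ball_lt_top.ne,
    fun _ hf _ hx => c.le_maximal hf.enorm hx⟩

theorem setLIntegral_dualWeight_lt_top (hw : Measurable w) (hpos : ∀ x, 0 < w x)
    (hu : IsPosWeight u) {p : ℝ} (hp : 1 < p) (h : MapsStrong c.maximalOperator p w u) {K : Set X}
    (hK : IsCompact K) : ∫⁻ x in K, dualWeight p w x < ∞ := by
  obtain ⟨t, ht, hKt⟩ := c.exists_finite_cover hK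
  have := ht.fintype
  refine (lintegral_mono_set hKt).trans_lt ?_
  rw [biUnion_eq_iUnion]
  refine (lintegral_iUnion_le _ _).trans_lt ?_
  rw [tsum_fintype]
  exact ENNReal.sum_lt_top.2 fun z _ =>
    (c.dominatesIntegral_maximalOperator z.1).setLIntegral_dualWeight_lt_top
      (c.measurableSet_lift_preimage_ball _ _) (c.volume_lift_preimage_ball_ne_top _ _) hw hpos hu
      hp h

theorem exists_ae_one_le_mul (hw : Measurable w) (hpos : ∀ x, 0 < w x) (hu : IsPosWeight u)
    (h : MapsIntoWeak c.maximalOperator w u) {K : Set X} (hK : IsCompact K) :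
    ∃ B : ℝ≥0, ∀ᵐ x ∂volume.restrict K, 1 ≤ B * ENNReal.ofReal (w x) := by
  choose B hB using fun z => (c.dominatesIntegral_maximalOperator z).exists_ae_one_le_mul
    (c.measurableSet_lift_preimage_ball _ _) (c.volume_lift_preimage_ball_ne_top _ _) hw hpos hu h
  obtain ⟨t, ht, hKt⟩ := c.exists_finite_cover hK
  obtain ⟨b, hb⟩ := (ht.image B).bddAbove
  refine ⟨b, ae_restrict_of_ae_restrict_of_subset hKt ?_⟩
  refine (ae_restrict_biUnion_iff _ ht.countable _).2 fun z hz => (hB z).mono fun x hx => ?_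
  calc (1 : ℝ≥0∞) ≤ B z * ENNReal.ofReal (w x) := hx
    _ ≤ b * ENNReal.ofReal (w x) := by
      gcongr
      exact hb (mem_image_of_mem B hz)

end LocalPieces

section Characterization

variable {X E : Type*} [TopologicalSpace X] [T2Space X] [MeasureSpace X] [BorelSpace X]
  [NormedAddCommGroup E] [NormedSpace ℝ E] [FiniteDimensional ℝ E] [MeasureSpace E] [BorelSpace E]
  [(volume : Measure E).IsAddHaarMeasure] {R : ℝ} (c : EuclideanCover X E R) {v : X → ℝ}

theorem memLocLp_rpow_iff (hv : IsPosWeight v) {p p' : ℝ} (hp : 1 < p)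
    (hpp' : 1 / p + 1 / p' = 1) :
    MemLocLp (fun x => v x ^ (-(1 / p))) (ENNReal.ofReal p') ↔
      ∃ u : X → ℝ, IsPosWeight u ∧ MapsStrong c.maximalOperator p v u := by
  obtain ⟨w, hw, hpos, hvw⟩ := hv.exists_measurable_pos
  simp only [memLocLp_rpow_iff_lintegral hw hpos hvw hp hpp', mapsStrong_congr_weight hvw]
  exact ⟨c.exists_mapsStrong hw hpos hp, fun ⟨u, hu, hmaps⟩ K hK =>
    c.setLIntegral_dualWeight_lt_top hw hpos hu hp hmaps hK⟩

theorem memLocLp_inv_tfae (hv : IsPosWeight v) :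
    List.TFAE [
      MemLocLp (fun x => (v x)⁻¹) ∞,
      ∃ u : X → ℝ, IsPosWeight u ∧ MapsIntoWeak c.maximalOperator v u,
      ∃ u : X → ℝ, IsPosWeight u ∧ MapsWeakBounded c.maximalOperator v u] := by
  obtain ⟨w, hw, hpos, hvw⟩ := hv.exists_measurable_pos
  simp only [memLocLp_inv_iff hw hpos hvw, mapsIntoWeak_congr_weight hvw,
    mapsWeakBounded_congr_weight hvw]
  tfae_have 1 → 3 := c.exists_mapsWeakBounded
  tfae_have 3 → 2 := fun ⟨u, hu, hmaps⟩ => ⟨u, hu, hmaps.mapsIntoWeak⟩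
  tfae_have 2 → 1 := fun ⟨u, hu, hmaps⟩ K hK => c.exists_ae_one_le_mul hw hpos hu hmaps hK
  tfae_finish

end Characterization

end EuclideanCover

section Circle

theorem coe_circleRep (x : UnitAddCircle) : (circleRep x : UnitAddCircle) = x :=
  AddCircle.coe_equivIco

theorem circleRep_mem (x : UnitAddCircle) : circleRep x ∈ Ico (-1 / 2 : ℝ) (1 / 2) := by
  have h : circleRep x ∈ Ico (-1 / 2 : ℝ) (-1 / 2 + 1) :=
    (AddCircle.equivIco (1 : ℝ) (-1 / 2) x).2
  norm_num at h ⊢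
  exact h

theorem circleRep_coe {t : ℝ} (ht : t ∈ Ico (-1 / 2 : ℝ) (1 / 2)) : circleRep t = t := by
  refine AddCircle.equivIco_coe_of_mem ?_
  norm_num at ht ⊢
  exact ht

theorem measurable_circleRep : Measurable circleRep :=
  measurable_subtype_coe.comp (AddCircle.measurableEquivIco 1 (-1 / 2)).measurable

theorem measurePreserving_circleRep :
    MeasurePreserving circleRep volume (volume.restrict (Ico (-1 / 2 : ℝ) (1 / 2))) := by
  refine ⟨measurable_circleRep, ?_⟩
  have hmk : (volume.restrict (Ico (-1 / 2 : ℝ) (1 / 2))).map ((↑) : ℝ → UnitAddCircle) =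
      volume := by
    rw [Measure.restrict_congr_set Ico_ae_eq_Ioc, show (1 / 2 : ℝ) = -1 / 2 + 1 by norm_num]
    exact (UnitAddCircle.measurePreserving_mk (-1 / 2)).map_eq
  rw [← hmk, Measure.map_map measurable_circleRep AddCircle.measurable_mk']
  refine (Measure.map_congr ?_).trans Measure.map_id
  exact (ae_restrict_mem measurableSet_Ico).mono fun t ht => circleRep_coe ht

theorem measurePreserving_unitAddCircle_mk_Ioc_neg_one_one :
    MeasurePreserving ((↑) : ℝ → UnitAddCircle) (volume.restrict (Ioc (-1 : ℝ) 1))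
      ((2 : ℝ≥0) • volume) := by
  refine ⟨AddCircle.measurable_mk', ?_⟩
  have h1 := (UnitAddCircle.measurePreserving_mk (-1)).map_eq
  have h2 := (UnitAddCircle.measurePreserving_mk 0).map_eq
  norm_num at h1 h2
  rw [← Ioc_union_Ioc_eq_Ioc (show (-1 : ℝ) ≤ 0 by norm_num) zero_le_one,
    Measure.restrict_union (Ioc_disjoint_Ioc_of_le le_rfl) measurableSet_Ioc,
    Measure.map_add _ _ AddCircle.measurable_mk', h1, h2, two_smul]

end Circle

section Regions

/-- The cube of points of `ℝ^ι` all of whose coordinates lie in `s`. -/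
def euclideanCube (ι : Type*) (s : Set ℝ) : Set (EuclideanSpace ℝ ι) :=
  WithLp.ofLp ⁻¹' univ.pi fun _ => s

/-- The strip of points of `ℝ^ι × ℝ^κ` whose first coordinates lie in `s`. -/
def euclideanStrip (ι κ : Type*) (s : Set ℝ) : Set (EuclideanSpace ℝ (ι ⊕ κ)) :=
  (fun z => (fun i => z (.inl i), fun j => z (.inr j)) :
    EuclideanSpace ℝ (ι ⊕ κ) → (ι → ℝ) × (κ → ℝ)) ⁻¹' ((univ.pi fun _ => s) ×ˢ univ)

theorem euclideanCube_mono (ι : Type*) {s t : Set ℝ} (h : s ⊆ t) :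
    euclideanCube ι s ⊆ euclideanCube ι t :=
  fun _ hz i hi => h (hz i hi)

theorem euclideanStrip_mono (ι κ : Type*) {s t : Set ℝ} (h : s ⊆ t) :
    euclideanStrip ι κ s ⊆ euclideanStrip ι κ t :=
  fun _ hz => ⟨fun i hi => h (hz.1 i hi), mem_univ _⟩

theorem Ico_neg_half_half_subset_Ioc : Ico (-1 / 2 : ℝ) (1 / 2) ⊆ Ioc (-1) 1 :=
  fun _ ht => ⟨by linarith [ht.1], by linarith [ht.2]⟩

end Regions

section MeasurePreserving

variable {ι κ : Type*} [Fintype ι] [Fintype κ]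

theorem measurePreserving_circleRep_pi :
    MeasurePreserving (fun (x : UnitAddTorus ι) i => circleRep (x i)) volume
      (volume.restrict (univ.pi fun _ => Ico (-1 / 2 : ℝ) (1 / 2))) := by
  rw [volume_pi, volume_pi, Measure.restrict_pi_pi]
  exact measurePreserving_pi _ _ fun _ => measurePreserving_circleRep

theorem measurePreserving_unitAddTorus_mk_Ioc_neg_one_one :
    MeasurePreserving (fun (z : ι → ℝ) i => (z i : UnitAddCircle))
      (volume.restrict (univ.pi fun _ => Ioc (-1 : ℝ) 1))
      ((2 : ℝ≥0) ^ Fintype.card ι • (volume : Measure (UnitAddTorus ι))) := by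
  have h : ((2 : ℝ≥0) ^ Fintype.card ι • (volume : Measure (UnitAddTorus ι))) =
      Measure.pi fun _ => (2 : ℝ≥0) • volume := by
    refine (Measure.pi_eq fun s _ => ?_).symm
    simp [Measure.smul_apply, volume_pi_pi, Finset.prod_mul_distrib, ENNReal.smul_def]
  rw [h, volume_pi, Measure.restrict_pi_pi]
  exact measurePreserving_pi _ _ fun _ => measurePreserving_unitAddCircle_mk_Ioc_neg_one_one

theorem measurePreserving_euclideanSpace_sumElim :
    MeasurePreserving (fun w : (ι → ℝ) × (κ → ℝ) =>
      (WithLp.toLp 2 (Sum.elim w.1 w.2) : EuclideanSpace ℝ (ι ⊕ κ))) := by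
  convert! (PiLp.volume_preserving_toLp (ι ⊕ κ)).comp
    (volume_measurePreserving_sumPiEquivProdPi_symm fun _ : ι ⊕ κ => ℝ) using 1

theorem measurePreserving_euclideanSpace_inl_inr :
    MeasurePreserving (fun z : EuclideanSpace ℝ (ι ⊕ κ) =>
      ((fun i => z (.inl i), fun j => z (.inr j)) : (ι → ℝ) × (κ → ℝ))) :=
  (volume_measurePreserving_sumPiEquivProdPi fun _ : ι ⊕ κ => ℝ).comp
    (PiLp.volume_preserving_ofLp (ι ⊕ κ))

theorem abs_apply_sub_lt_of_mem_ball {y z : EuclideanSpace ℝ ι} {r : ℝ}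
    (h : y ∈ Metric.ball z r) (i : ι) : |y i - z i| < r := by
  rw [mem_ball_iff_norm] at h
  exact (PiLp.norm_apply_le (y - z) i).trans_lt h

theorem apply_mem_Ioc_of_mem_ball {y z : EuclideanSpace ℝ ι} {i : ι}
    (hz : z i ∈ Ico (-1 / 2 : ℝ) (1 / 2)) (h : y ∈ Metric.ball z (1 / 2)) :
    y i ∈ Ioc (-1 : ℝ) 1 := by
  obtain ⟨h1, h2⟩ := abs_lt.1 (abs_apply_sub_lt_of_mem_ball h i)
  exact ⟨by linarith [hz.1], by linarith [hz.2]⟩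

theorem measurePreserving_torus_lift :
    MeasurePreserving
      (fun x : UnitAddTorus ι => (WithLp.toLp 2 fun i => circleRep (x i) : EuclideanSpace ℝ ι))
      volume (volume.restrict (euclideanCube ι (Ico (-1 / 2) (1 / 2)))) :=
  ((PiLp.volume_preserving_toLp ι).restrict_preimage
    ((PiLp.volume_preserving_ofLp ι).measurable (.univ_pi fun _ => measurableSet_Ico))).comp
    measurePreserving_circleRep_pi

theorem measurePreserving_torus_proj :
    MeasurePreserving (fun (z : EuclideanSpace ℝ ι) i => (z i : UnitAddCircle))
      (volume.restrict (euclideanCube ι (Ioc (-1) 1)))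
      ((2 : ℝ≥0) ^ Fintype.card ι • (volume : Measure (UnitAddTorus ι))) :=
  measurePreserving_unitAddTorus_mk_Ioc_neg_one_one.comp
    ((PiLp.volume_preserving_ofLp ι).restrict_preimage (.univ_pi fun _ => measurableSet_Ioc))

theorem measurePreserving_waveguide_lift :
    MeasurePreserving
      (fun x : UnitAddTorus ι × EuclideanSpace ℝ κ =>
        (WithLp.toLp 2 (Sum.elim (fun i => circleRep (x.1 i)) fun j => x.2 j) :
          EuclideanSpace ℝ (ι ⊕ κ)))
      volume (volume.restrict (euclideanStrip ι κ (Ico (-1 / 2) (1 / 2)))) := by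
  have hprod := (measurePreserving_circleRep_pi (ι := ι)).prod (PiLp.volume_preserving_ofLp κ)
  rw [← Measure.restrict_univ (μ := (volume : Measure (κ → ℝ))), Measure.prod_restrict] at hprod
  exact (measurePreserving_euclideanSpace_sumElim.restrict_preimage
    (measurePreserving_euclideanSpace_inl_inr.measurable
      ((MeasurableSet.univ_pi fun _ => measurableSet_Ico).prod .univ))).comp hprod

theorem measurePreserving_waveguide_proj :
    MeasurePreserving
      (fun z : EuclideanSpace ℝ (ι ⊕ κ) => ((fun i => (z (.inl i) : UnitAddCircle),
        WithLp.toLp 2 fun j => z (.inr j)) : UnitAddTorus ι × EuclideanSpace ℝ κ))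
      (volume.restrict (euclideanStrip ι κ (Ioc (-1) 1)))
      ((2 : ℝ≥0) ^ Fintype.card ι • volume) := by
  have hprod := (measurePreserving_unitAddTorus_mk_Ioc_neg_one_one (ι := ι)).prod
    (PiLp.volume_preserving_toLp κ)
  rw [← Measure.restrict_univ (μ := (volume : Measure (κ → ℝ))), Measure.prod_restrict] at hprod
  have hcomp := hprod.comp (measurePreserving_euclideanSpace_inl_inr.restrict_preimage
    ((MeasurableSet.univ_pi fun _ => measurableSet_Ioc).prod .univ))
  exact ⟨hcomp.measurable, hcomp.map_eq.trans (Measure.prod_smul_left _)⟩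

end MeasurePreserving

section BoundedLifts

variable {ι κ : Type*}

theorem continuous_toLp_sumElim : Continuous fun w : (ι → ℝ) × EuclideanSpace ℝ κ =>
    (WithLp.toLp 2 (Sum.elim w.1 w.2) : EuclideanSpace ℝ (ι ⊕ κ)) := by
  refine (PiLp.continuous_toLp 2 _).comp (continuous_pi fun i => ?_)
  cases i
  · simp only [Sum.elim_inl]; fun_prop
  · simp only [Sum.elim_inr]; fun_prop

variable [Finite ι]

theorem isBounded_range_torus_lift : Bornology.IsBounded (range fun x : UnitAddTorus ι =>
    (WithLp.toLp 2 fun i => circleRep (x i) : EuclideanSpace ℝ ι)) := by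
  have := Fintype.ofFinite ι
  have hcube : IsCompact (WithLp.toLp 2 '' univ.pi fun _ : ι => Icc (-1 / 2 : ℝ) (1 / 2)) :=
    (isCompact_univ_pi fun _ => isCompact_Icc).image (PiLp.continuous_toLp 2 _)
  refine hcube.isBounded.subset ?_
  rintro _ ⟨x, rfl⟩
  exact mem_image_of_mem _ fun i _ => Ico_subset_Icc_self (circleRep_mem (x i))

theorem isBounded_waveguide_lift_image [Finite κ] {K : Set (UnitAddTorus ι × EuclideanSpace ℝ κ)}
    (hK : IsCompact K) : Bornology.IsBounded ((fun x : UnitAddTorus ι × EuclideanSpace ℝ κ =>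
      (WithLp.toLp 2 (Sum.elim (fun i => circleRep (x.1 i)) fun j => x.2 j) :
        EuclideanSpace ℝ (ι ⊕ κ))) '' K) := by
  have := Fintype.ofFinite ι
  have := Fintype.ofFinite κ
  have hbox : IsCompact ((univ.pi fun _ : ι => Icc (-1 / 2 : ℝ) (1 / 2)) ×ˢ (Prod.snd '' K)) :=
    (isCompact_univ_pi fun _ => isCompact_Icc).prod (hK.image continuous_snd)
  refine (hbox.image continuous_toLp_sumElim).isBounded.subset ?_
  rintro _ ⟨x, hx, rfl⟩
  exact ⟨(fun i => circleRep (x.1 i), x.2),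
    ⟨fun i _ => Ico_subset_Icc_self (circleRep_mem (x.1 i)), mem_image_of_mem _ hx⟩, rfl⟩

end BoundedLifts

/-- The presentation of `𝕋ⁿ` as `ℝⁿ/ℤⁿ`, with the representatives in `Q_n`. -/
noncomputable def torusCover (n : ℕ) :
    EuclideanCover (UnitAddTorus (Fin n)) (EuclideanSpace ℝ (Fin n)) (1 / 2) where
  proj z i := (z i : UnitAddCircle)
  lift x := WithLp.toLp 2 fun i => circleRep (x i)
  region := euclideanCube (Fin n) (Ioc (-1) 1)
  multiplicity := 2 ^ Fintype.card (Fin n)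
  radius_pos := by norm_num
  continuous_proj := continuous_pi fun i =>
    (AddCircle.continuous_mk' 1).comp (by fun_prop : Continuous fun z : EuclideanSpace ℝ _ => z i)
  proj_lift x := funext fun i => coe_circleRep (x i)
  measurable_lift := measurePreserving_torus_lift.measurable
  map_lift_le := measurePreserving_torus_lift.map_eq.le.trans <|
    Measure.restrict_mono (euclideanCube_mono _ Ico_neg_half_half_subset_Ioc) le_rfl
  ball_subset x _ hy := fun i _ => apply_mem_Ioc_of_mem_ball (circleRep_mem (x i)) hy
  map_proj_le := measurePreserving_torus_proj.map_eq.le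
  isBounded_lift _ _ := isBounded_range_torus_lift.subset (image_subset_range _ _)

/-- The presentation of `𝕋ⁿ × ℝᵐ` as a quotient of `ℝ^{n+m}`, with the representatives in
`Q_n × ℝᵐ`. -/
noncomputable def waveguideCover (n m : ℕ) :
    EuclideanCover (Waveguide n m) (EuclideanSpace ℝ (Fin n ⊕ Fin m)) (1 / 2) where
  proj z := (fun i => (z (.inl i) : UnitAddCircle), WithLp.toLp 2 fun j => z (.inr j))
  lift x := WithLp.toLp 2 (Sum.elim (fun i => circleRep (x.1 i)) fun j => x.2 j)
  region := euclideanStrip (Fin n) (Fin m) (Ioc (-1) 1)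
  multiplicity := 2 ^ Fintype.card (Fin n)
  radius_pos := by norm_num
  continuous_proj := .prodMk (continuous_pi fun i => (AddCircle.continuous_mk' 1).comp
    (by fun_prop : Continuous fun z : EuclideanSpace ℝ (Fin n ⊕ Fin m) => z (.inl i)))
    (by fun_prop)
  proj_lift x := Prod.ext (funext fun i => coe_circleRep (x.1 i)) rfl
  measurable_lift := measurePreserving_waveguide_lift.measurable
  map_lift_le := measurePreserving_waveguide_lift.map_eq.le.trans <|
    Measure.restrict_mono (euclideanStrip_mono _ _ Ico_neg_half_half_subset_Ioc) le_rfl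
  ball_subset x _ hy :=
    ⟨fun i _ => apply_mem_Ioc_of_mem_ball (circleRep_mem (x.1 i)) hy, mem_univ _⟩
  map_proj_le := measurePreserving_waveguide_proj.map_eq.le
  isBounded_lift _ hK := isBounded_waveguide_lift_image hK

theorem torusCover_maximalOperator (n : ℕ) : (torusCover n).maximalOperator = torusMaximal n := rfl

theorem waveguideCover_maximalOperator (n m : ℕ) :
    (waveguideCover n m).maximalOperator = waveguideMaximal n m := rfl

theorem proposition3p3 :
    (∀ (n : ℕ) (v : UnitAddTorus (Fin n) → ℝ), IsPosWeight v →
      (∀ p p' : ℝ, 1 < p → 1 / p + 1 / p' = 1 →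
        (MemLp (fun x => v x ^ (-(1 / p))) (ENNReal.ofReal p') volume ↔
          ∃ u : UnitAddTorus (Fin n) → ℝ, IsPosWeight u ∧ MapsStrong (torusMaximal n) p v u)) ∧
      List.TFAE [
        MemLp (fun x => (v x)⁻¹) ∞ volume,
        ∃ u : UnitAddTorus (Fin n) → ℝ, IsPosWeight u ∧ MapsIntoWeak (torusMaximal n) v u,
        ∃ u : UnitAddTorus (Fin n) → ℝ, IsPosWeight u ∧ MapsWeakBounded (torusMaximal n) v u]) ∧
    (∀ (n m : ℕ) (v : Waveguide n m → ℝ), IsPosWeight v →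
      (∀ p p' : ℝ, 1 < p → 1 / p + 1 / p' = 1 →
        (MemLocLp (fun z => v z ^ (-(1 / p))) (ENNReal.ofReal p') ↔
          ∃ u : Waveguide n m → ℝ, IsPosWeight u ∧ MapsStrong (waveguideMaximal n m) p v u)) ∧
      List.TFAE [
        MemLocLp (fun z => (v z)⁻¹) ∞,
        ∃ u : Waveguide n m → ℝ, IsPosWeight u ∧ MapsIntoWeak (waveguideMaximal n m) v u,
        ∃ u : Waveguide n m → ℝ, IsPosWeight u ∧ MapsWeakBounded (waveguideMaximal n m) v u]) := by
  refine ⟨fun n v hv => ⟨fun p p' hp hpp' => ?_, ?_⟩,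
    fun n m v hv => ⟨fun p p' hp hpp' => ?_, ?_⟩⟩
  · rw [← memLocLp_iff_memLp, ← torusCover_maximalOperator]
    exact (torusCover n).memLocLp_rpow_iff hv hp hpp'
  · rw [← memLocLp_iff_memLp, ← torusCover_maximalOperator]
    exact (torusCover n).memLocLp_inv_tfae hv
  · rw [← waveguideCover_maximalOperator]
    exact (waveguideCover n m).memLocLp_rpow_iff hv hp hpp'
  · rw [← waveguideCover_maximalOperator]
    exact (waveguideCover n m).memLocLp_inv_tfae hv
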